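/- **Setting.** Let $\mathcal R$ be a concrete ring family: each string $id$ names a finite ring $R=\mathcal R_{id}$ (not necessarily commutative or unital) whose elements are represented by distinct strings of length $|id|$; all machines have oracle access to the ring operations (and, for families with inverse, to the identity and to inverses of units) and can sample uniform ring elements. Let $\mathcal F_{\text{pdt-shr}}$ be the functionality that receives $a\in R$ from $A$ and $b\in R$ from $B$, samples a uniformly random pair $(z^A,z^B)\in R^2$ with $z^A+z^B=ab$, and gives $z^A$ to $A$ and $z^B$ to $B$. Protocols are synchronous polynomial-time two-party protocols in the OT-hybrid model with private channels; $k$ is the security parameter, and $id$ is a common input chosen by the environment. "Indistinguishable" means that the acceptance probabilities differ by a function that is negligible in $k$. In the computational setting this is required for non-uniform probabilistic polynomial-time environments, in the statistical setting for computationally unbounded ones; simulators are always probabilistic polynomial time. **Hypothesis.** A protocol $\pi$ *securely realizes $\mathcal F_{\text{pdt-shr}}$ on random inputs, against (static) passive corruption, with special simulation* if there is a simulator $\mathsf{Sim}$ such that the following holds for each choice of the corrupt party $P\in\{A,B\}$, with $H$ the other party, when the inputs $x_A,x_B\in R$ are independent and uniform. $\mathsf{Sim}$ sends $x_P$ to the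 functionality and receives $z_P$; from $(x_P,z_P)$ it chooses an input $x'_H$ for a simulated party $H$ and random tapes $\omega_A,\omega_B$ for both parties; it aborts if, in the execution of $\pi$ that these choices determine, the output of $P$ is not $z_P$, and otherwise reports the view of $P$ in this execution. It is required that 1. $(x_P,x'_H,\omega_A,\omega_B)$ is indistinguishable from uniform inputs and uniform random tapes; 2. the two inputs, the report of $\mathsf{Sim}$ and the output of $H$ given by the functionality are jointly indistinguishable from the two inputs, the view of $P$ and the output of $H$ in the real execution of $\pi$. **Protocol $\tilde\pi$**, on inputs $a$ of $A$ and $b$ of $B$: 1. $A$ and $B$ pick uniformly random $r^A,r^B\in R$. 2. They run $\pi$ on the inputs $r^A,r^B$ and obtain outputs $s^A,s^B$. 3. Each party erases everything about the run of $\pi$ except its input and output in it. 4. $A$ sends $a-r^A$ to $B$, and $B$ sends $b-r^B$ to $A$. 5. $A$ outputs $a(b-r^B)+s^A$, and $B$ outputs $(a-r^A)r^B+s^B$. **Adaptive security.** A protocol with erasures *securely realizes $\mathcal F_{\text{pdt-shr}}$ against adaptive passive corruption with erasures* if its honest parties run in polynomial time and there is a simulator such that no environment can distinguish the following two executions. The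 environment chooses both inputs; before, between and after the rounds it may at any time, depending on all it has seen, corrupt either party or both. In the real execution it sees, from the time of corruption on, the current internal state of each corrupt party (everything that the party has not erased), and it sees the outputs of the parties that are honest when outputs are delivered. In the ideal execution the outputs of honest parties come from the functionality, and the states of corrupt parties are reported by the simulator, which learns a party's input and its output from the functionality when that party is corrupted, and nothing else about the inputs and outputs. **Lemma.** In the computational as well as in the statistical setting: if $\pi$ securely realizes $\mathcal F_{\text{pdt-shr}}$ on random inputs, against passive corruption, with special simulation, then $\tilde\pi$ securely realizes $\mathcal F_{\text{pdt-shr}}$ against adaptive passive corruption with erasures. In particular, if the security of $\pi$ is statistical, so is that of $\tilde\pi$. -/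

import Mathlib

noncomputable section

namespace ProdShare

/-! ## Data and encodings -/

/-- Finite binary trees: the values on which machines compute and which parties exchange. -/
inductive Data : Type
  | nil : Data
  | cons : Data → Data → Data

namespace Data

/-- Number of nodes. -/
def size : Data → ℕ
  | nil => 1
  | cons a b => 1 + size a + size b

def fst : Data → Data
  | nil => nil
  | cons a _ => a

def snd : Data → Data
  | nil => nil
  | cons _ b => b

/-- Length of a tree read as a list. -/
def len : Data → ℕ
  | nil => 0
  | cons _ b => len b + 1

/-- A tree read as a bit. -/
def toBool : Data → Bool
  | nil => false
  | cons _ _ => true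

def bit : Bool → Data
  | false => nil
  | true => cons nil nil

def list : List Data → Data
  | [] => nil
  | a :: l => cons a (list l)

/-- A bit string. -/
def bits (l : List Bool) : Data := list (l.map bit)

/-- The number `n` in unary. -/
def unary (n : ℕ) : Data := list (List.replicate n nil)

/-- Partial inverse of `bits`. -/
def decBits : Data → Option (List Bool)
  | nil => some []
  | cons nil t => (decBits t).map (List.cons false)
  | cons (cons nil nil) t => (decBits t).map (List.cons true)
  | cons _ _ => none

theorem decBits_bits (l : List Bool) : decBits (bits l) = some l := by
  induction l with
  | nil => rfl
  | cons b l ih =>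
    have h : bits (b :: l) = cons (bit b) (bits l) := rfl
    cases b <;> simp [h, bit, decBits, ih]

theorem bits_injective : Function.Injective bits := fun a b h => by
  have := congrArg decBits h
  simpa [decBits_bits] using this

end Data

open Data

/-! ## Concrete ring families -/

/-- A concrete ring family: every string `id` names a finite (associative, possibly noncommutative
and non-unital) ring, whose elements are represented by distinct strings of length `|id|`.
If `withInverse` holds, every ring has an identity, and the oracle also gives access to the
identity and to inverses of units. -/
structure RingFamily where
  Carrier : List Bool → Type
  ring : ∀ id, NonUnitalRing (Carrier id)
  fintype : ∀ id, Fintype (Carrier id)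
  label : ∀ id, Carrier id → List Bool
  label_injective : ∀ id, Function.Injective (label id)
  label_length : ∀ id x, (label id x).length = id.length
  withInverse : Prop
  unital : withInverse → ∀ id, ∃ e : Carrier id, ∀ x : Carrier id, e * x = x ∧ x * e = x

attribute [instance] RingFamily.ring RingFamily.fintype

instance (R : RingFamily) (id : List Bool) : Nonempty (R.Carrier id) := ⟨0⟩

inductive RingOp : Type
  | add | sub | mul

def RingOp.apply {α : Type} [NonUnitalRing α] : RingOp → α → α → α
  | .add, x, y => x + y
  | .sub, x, y => x - y
  | .mul, x, y => x * y

namespace RingFamily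

/-- The label of a ring element, as data. -/
def elt (R : RingFamily) (id : List Bool) (x : R.Carrier id) : Data := bits (R.label id x)

theorem elt_injective (R : RingFamily) (id : List Bool) : Function.Injective (R.elt id) :=
  fun _ _ h => R.label_injective id (bits_injective h)

/-- The ring oracle on labels; the answer to invalid labels is `nil`
(which is not a label, except in the one-element ring named by the empty string). -/
def query (R : RingFamily) (op : RingOp) (id : List Bool) (u v : Data) : Data :=
  match Function.partialInv (R.elt id) u, Function.partialInv (R.elt id) v with
  | some x, some y => R.elt id (op.apply x y)
  | _, _ => nil

theorem query_elt (R : RingFamily) (op : RingOp) (id : List Bool) (x y : R.Carrier id) :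
    R.query op id (R.elt id x) (R.elt id y) = R.elt id (op.apply x y) := by
  simp [query, Function.partialInv_left (R.elt_injective id)]

open Classical in
/-- The oracle answer to the command "one". -/
def queryOne (R : RingFamily) (id : List Bool) : Data :=
  if h : R.withInverse then R.elt id (R.unital h id).choose else nil

open Classical in
/-- The oracle answer to the command "invert". -/
def queryInvert (R : RingFamily) (id : List Bool) (u : Data) : Data :=
  if h : R.withInverse ∧ ∃ y x e : R.Carrier id, R.elt id x = u ∧
      (∀ w, e * w = w ∧ w * e = w) ∧ x * y = e ∧ y * x = e
  then R.elt id h.2.choose else nil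

end RingFamily

/-! ## Machines with step counts

Programs are deterministic, with access to the ring oracle; randomness (coins and samples of the
ring oracle) is always read from an explicit random tape.  Every elementary operation is charged
the size of the data it reads and writes.  Loops are counted loops; with a polynomially long counter
they simulate any polynomial-time Turing machine, and conversely a program of
polynomial cost is simulated by a Turing machine (with ring oracle) in polynomial time. -/

inductive Prog : Type
  | ident : Prog
  | nil : Prog
  | fst : Prog
  | snd : Prog
  /-- run both programs on the input and pair the results -/
  | pair : Prog → Prog → Prog
  /-- `comp q p`: first `p`, then `q` -/
  | comp : Prog → Prog → Prog
  /-- `cond p q r`: run `q` if the result of `p` is true (not `nil`), and `r` otherwise -/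
  | cond : Prog → Prog → Prog → Prog
  /-- on input `(n, s)`, apply the body to `s` as many times as `n` has nodes -/
  | iter : Prog → Prog
  | ring : RingOp → Prog
  | one : Prog
  | invert : Prog

namespace Prog

/-- Oracle call of the command `op` on input `(id, (u, v))`. -/
def callRing (R : RingFamily) (op : RingOp) (x : Data) : Data :=
  match decBits x.fst with
  | some id => R.query op id x.snd.fst x.snd.snd
  | none => Data.nil

/-- Oracle call of the command "one" on input `id`. -/
def callOne (R : RingFamily) (x : Data) : Data :=
  match decBits x with
  | some id => R.queryOne id
  | none => Data.nil

/-- Oracle call of the command "invert" on input `(id, u)`. -/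
def callInvert (R : RingFamily) (x : Data) : Data :=
  match decBits x.fst with
  | some id => R.queryInvert id x.snd
  | none => Data.nil

/-- The result of a program. -/
def run (R : RingFamily) : Prog → Data → Data
  | ident, x => x
  | nil, _ => Data.nil
  | fst, x => x.fst
  | snd, x => x.snd
  | pair p q, x => Data.cons (run R p x) (run R q x)
  | comp q p, x => run R q (run R p x)
  | cond p q r, x => if (run R p x).toBool = true then run R q x else run R r x
  | iter p, x => (run R p)^[x.fst.size] x.snd
  | ring op, x => callRing R op x
  | one, x => callOne R x
  | invert, x => callInvert R x

/-- The number of steps of a program. -/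
def cost (R : RingFamily) : Prog → Data → ℕ
  | ident, x => 1 + x.size
  | nil, x => 1 + x.size
  | fst, x => 1 + x.size
  | snd, x => 1 + x.size
  | pair p q, x => 1 + x.size + cost R p x + cost R q x
  | comp q p, x => 1 + cost R p x + cost R q (run R p x)
  | cond p q r, x =>
      1 + x.size + cost R p x + if (run R p x).toBool = true then cost R q x else cost R r x
  | iter p, x =>
      1 + x.size + ∑ i ∈ Finset.range x.fst.size, cost R p ((run R p)^[i] x.snd)
  | ring op, x => 1 + x.size + (callRing R op x).size
  | one, x => 1 + x.size + (callOne R x).size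
  | invert, x => 1 + x.size + (callInvert R x).size

end Prog

/-- A function of the security parameter `k` (given in unary), a ring name `id` and a data item `x`
is polynomial time if some program computes it within a number of steps that is polynomial in
the length of its input. -/
def PolyTime (R : RingFamily) (f : ℕ → List Bool → Data → Data) : Prop :=
  ∃ (p : Prog) (q : Polynomial ℕ), ∀ k id x,
    p.run R (cons (unary k) (cons (bits id) x)) = f k id x ∧
    p.cost R (cons (unary k) (cons (bits id) x)) ≤
      q.eval (cons (unary k) (cons (bits id) x)).size

/-- A length `n k id` that can be written down in unary in polynomial time. -/
def PolyLength (R : RingFamily) (n : ℕ → List Bool → ℕ) : Prop :=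
  PolyTime R fun k id _ => unary (n k id)

/-! ## Randomness -/

/-- A random tape: `c` bits and `s` ring elements. -/
abbrev Tape (R : RingFamily) (id : List Bool) (c s : ℕ) : Type :=
  (Fin c → Bool) × (Fin s → R.Carrier id)

def Tape.enc {R : RingFamily} {id : List Bool} {c s : ℕ} (t : Tape R id c s) : Data :=
  cons (bits (List.ofFn t.1)) (list ((List.ofFn t.2).map (R.elt id)))

/-- The uniform distribution. -/
def unif (α : Type) [Fintype α] [Nonempty α] : PMF α := PMF.uniformOfFintype α

/-- The probability that a random data item is true. -/
def prTrue (X : PMF Data) : ℝ := ((X.map toBool) true).toReal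

/-- Negligible functions of the security parameter. -/
def Negligible (f : ℕ → ℝ) : Prop :=
  Asymptotics.SuperpolynomialDecay Filter.atTop (fun k : ℕ => (k : ℝ)) f

/-- Computational security (against non-uniform polynomial-time environments) or statistical
security (against computationally unbounded environments). -/
inductive Setting : Type
  | computational | statistical

/-! ## Two-party protocols in the OT-hybrid model -/

inductive Party : Type
  | A | B
  deriving DecidableEq

instance : Fintype Party := ⟨{.A, .B}, fun P => by cases P <;> simp⟩

def Party.other : Party → Party
  | .A => .B
  | .B => .A

def Party.bit : Party → Bool
  | .A => false
  | .B => true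

/-- Parallel 1-out-of-2 string OT: the receiver supplies the list of choice bits, the sender the
list of pairs of strings. -/
def otAnswers : Data → Data → Data
  | cons c cs, cons w ws =>
      cons (if c.toBool = true then w.snd else w.fst) (otAnswers cs ws)
  | _, _ => nil

/-- In a round each party hands over `(m, (w, c))`: a message `m` for the other party, pairs `w` for
the OTs in which it is the sender, and choice bits `c` for the OTs in which it is the receiver.
`deliver own other` is what a party gets back: the other party's message and the OT answers.
Channels are private. -/
def deliver (own other : Data) : Data :=
  cons other.fst (otAnswers own.snd.snd other.snd.fst)

/-- A protocol without erasures, given by its next-message and output functions.  They are applied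
to the view `(input, (tape, received))` of a party, `received` being the list of the items
delivered to it so far, the latest one first. -/
structure Protocol where
  rounds : ℕ → List Bool → ℕ
  coins : ℕ → List Bool → ℕ
  samples : ℕ → List Bool → ℕ
  next : Party → ℕ → List Bool → Data → Data
  out : Party → ℕ → List Bool → Data → Data

namespace Protocol

/-- Honest parties run in polynomial time, and messages and outputs have polynomial length. -/
def Efficient (R : RingFamily) (π : Protocol) : Prop :=
  PolyLength R π.rounds ∧ PolyLength R π.coins ∧ PolyLength R π.samples ∧
  (∀ P, PolyTime R (π.next P)) ∧ (∀ P, PolyTime R (π.out P)) ∧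
  ∃ q : Polynomial ℕ, ∀ P k id v,
    (π.next P k id v).size ≤ q.eval (k + id.length) ∧
    (π.out P k id v).size ≤ q.eval (k + id.length)

/-- The items received in the first `t` rounds, on inputs `x` and tapes `ω`. -/
def received (π : Protocol) (k : ℕ) (id : List Bool) (x ω : Party → Data) : ℕ → Party → Data
  | 0 => fun _ => nil
  | t + 1 => fun P =>
      let msg : Party → Data := fun Q =>
        π.next Q k id (cons (x Q) (cons (ω Q) (received π k id x ω t Q)))
      cons (deliver (msg P) (msg P.other)) (received π k id x ω t P)

/-- The view of a party in a complete execution. -/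
def view (π : Protocol) (k : ℕ) (id : List Bool) (x ω : Party → Data) (P : Party) : Data :=
  cons (x P) (cons (ω P) (π.received k id x ω (π.rounds k id) P))

/-- The output of a party in a complete execution. -/
def output (π : Protocol) (k : ℕ) (id : List Bool) (x ω : Party → Data) (P : Party) : Data :=
  π.out P k id (π.view k id x ω P)

/-- The random tape of one party. -/
abbrev PTape (R : RingFamily) (π : Protocol) (k : ℕ) (id : List Bool) : Type :=
  Tape R id (π.coins k id) (π.samples k id)

end Protocol

/-- The product-sharing functionality: a uniformly random pair of shares `z A`, `z B` with
`z A + z B = a * b`. -/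
def pdtShr (R : RingFamily) (id : List Bool) (a b : R.Carrier id) :
    PMF (Party → R.Carrier id) :=
  (unif (R.Carrier id)).map fun z P =>
    match P with
    | .A => z
    | .B => a * b - z

/-! ## Static passive security on random inputs, with special simulation -/

/-- A distinguisher: it fixes the ring to be used, and computes a bit from its advice, a random tape
and the data item that it is given. -/
structure Distinguisher where
  id : ℕ → List Bool
  advice : ℕ → Data
  coins : ℕ → ℕ
  samples : ℕ → ℕ
  decide : ℕ → List Bool → Data → Data

/-- Unrestricted in the statistical setting, non-uniform polynomial time in the
computational one. -/
def Distinguisher.Admissible (R : RingFamily) (D : Distinguisher) : Setting → Prop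
  | .statistical => True
  | .computational => PolyTime R D.decide ∧ ∃ q : Polynomial ℕ, ∀ k,
      (D.id k).length ≤ q.eval k ∧ (D.advice k).size ≤ q.eval k ∧
      D.coins k ≤ q.eval k ∧ D.samples k ≤ q.eval k

/-- The probability that the distinguisher accepts a sample of `X`. -/
def Distinguisher.prob (R : RingFamily) (D : Distinguisher) (k : ℕ) (X : PMF Data) : ℝ :=
  prTrue <| do
    let x ← X
    let τ ← unif (Tape R (D.id k) (D.coins k) (D.samples k))
    pure (D.decide k (D.id k) (list [D.advice k, τ.enc, x]))

/-- Indistinguishability of two families of distributions. -/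
def Indist (R : RingFamily) (s : Setting) (X Y : ℕ → List Bool → PMF Data) : Prop :=
  ∀ D : Distinguisher, D.Admissible R s →
    Negligible fun k => D.prob R k (X k (D.id k)) - D.prob R k (Y k (D.id k))

/-- A special simulator for one corrupt party `P`.  Given the input of `P`, the output for `P`
obtained from the functionality and a random tape, it chooses `(x', (ωA, ωB))`: an input for the
simulated honest party and random tapes for both parties. -/
structure SpecialSim where
  coins : ℕ → List Bool → ℕ
  samples : ℕ → List Bool → ℕ
  choose : Party → ℕ → List Bool → Data → Data

namespace SpecialSim

def Efficient (R : RingFamily) (S : SpecialSim) : Prop :=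
  PolyLength R S.coins ∧ PolyLength R S.samples ∧ ∀ P, PolyTime R (S.choose P)

abbrev STape (R : RingFamily) (S : SpecialSim) (k : ℕ) (id : List Bool) : Type :=
  Tape R id (S.coins k id) (S.samples k id)

/-- The choice made when the corrupt party `P` has input `x` and the functionality returned `z`. -/
def choice (R : RingFamily) (S : SpecialSim) (P : Party) (k : ℕ) (id : List Bool)
    (x z : R.Carrier id) (σ : S.STape R k id) : Data :=
  S.choose P k id (list [R.elt id x, R.elt id z, σ.enc])

/-- The inputs in the simulated execution, for the choice `c`. -/
def simInputs (P : Party) (xP c : Data) : Party → Data := fun Q => if Q = P then xP else c.fst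

/-- The random tapes in the simulated execution, for the choice `c`. -/
def simTapes (c : Data) : Party → Data
  | .A => c.snd.fst
  | .B => c.snd.snd

open Classical in
/-- What the simulator reports to the environment: the view of the corrupt party `P` in the
simulated execution if its output there is the one given by the functionality; otherwise the
simulator aborts, which is reported as `nil`. -/
def report (R : RingFamily) (S : SpecialSim) (π : Protocol) (P : Party) (k : ℕ) (id : List Bool)
    (x z : R.Carrier id) (σ : S.STape R k id) : Data :=
  let c := S.choice R P k id x z σ
  let xs := simInputs P (R.elt id x) c
  let ωs := simTapes c
  if π.output k id xs ωs P = R.elt id z then cons nil (π.view k id xs ωs P) else nil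

/-- The simulator's choices, together with the random input of the corrupt party; the output it
gets is that of the functionality on random inputs. -/
def simulatedChoices (R : RingFamily) (S : SpecialSim) (P : Party) (k : ℕ) (id : List Bool) :
    PMF Data := do
  let x ← unif (Party → R.Carrier id)
  let z ← pdtShr R id (x .A) (x .B)
  let σ ← unif (S.STape R k id)
  let c := S.choice R P k id (x P) (z P) σ
  pure (list [R.elt id (x P), c.fst, c.snd.fst, c.snd.snd])

end SpecialSim

/-- Independent uniform inputs and random tapes. -/
def uniformChoices (R : RingFamily) (π : Protocol) (P : Party) (k : ℕ) (id : List Bool) :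
    PMF Data := do
  let x ← unif (Party → R.Carrier id)
  let ω ← unif (Party → π.PTape R k id)
  pure (list [R.elt id (x P), R.elt id (x P.other), (ω .A).enc, (ω .B).enc])

/-- What a random-input environment sees in the real execution when `P` is corrupt: the inputs, the
view of `P`, the output of the honest party. -/
def staticReal (R : RingFamily) (π : Protocol) (P : Party) (k : ℕ) (id : List Bool) :
    PMF Data := do
  let x ← unif (Party → R.Carrier id)
  let ω ← unif (Party → π.PTape R k id)
  let xs : Party → Data := fun Q => R.elt id (x Q)
  let ωs : Party → Data := fun Q => (ω Q).enc
  pure (list [xs .A, xs .B, cons nil (π.view k id xs ωs P), π.output k id xs ωs P.other])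

/-- What a random-input environment sees in the ideal execution when `P` is corrupt: the inputs, the
report of the simulator, the output of the honest party from the functionality. -/
def staticIdeal (R : RingFamily) (π : Protocol) (S : SpecialSim) (P : Party) (k : ℕ)
    (id : List Bool) : PMF Data := do
  let x ← unif (Party → R.Carrier id)
  let z ← pdtShr R id (x .A) (x .B)
  let σ ← unif (S.STape R k id)
  pure (list [R.elt id (x .A), R.elt id (x .B), S.report R π P k id (x P) (z P) σ,
    R.elt id (z P.other)])

/-- `π` securely realizes product-sharing on random inputs, against (static) passive corruption,
with special simulation. -/
def RealizesOnRandomInputs (R : RingFamily) (s : Setting) (π : Protocol) : Prop :=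
  π.Efficient R ∧ ∃ S : SpecialSim, S.Efficient R ∧ ∀ P : Party,
    Indist R s (S.simulatedChoices R P) (uniformChoices R π P) ∧
    Indist R s (staticReal R π P) (staticIdeal R π S P)

/-! ## Adaptive passive security with erasures -/

/-- A protocol with erasures: a party remembers nothing but its current state. -/
structure ErasingProtocol where
  rounds : ℕ → List Bool → ℕ
  coins : ℕ → List Bool → ℕ
  samples : ℕ → List Bool → ℕ
  /-- initial state, from the pair (input, random tape) -/
  start : Party → ℕ → List Bool → Data → Data
  /-- what is handed over in the next round, from the state -/
  send : Party → ℕ → List Bool → Data → Data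
  /-- the new state, from the pair (old state, delivered item) -/
  recv : Party → ℕ → List Bool → Data → Data
  /-- the output, from the final state -/
  out : Party → ℕ → List Bool → Data → Data

namespace ErasingProtocol

/-- Honest parties run in polynomial time, messages have polynomial length, and a round adds
polynomially much to the state. -/
def Efficient (R : RingFamily) (ρ : ErasingProtocol) : Prop :=
  PolyLength R ρ.rounds ∧ PolyLength R ρ.coins ∧ PolyLength R ρ.samples ∧
  (∀ P, PolyTime R (ρ.start P)) ∧ (∀ P, PolyTime R (ρ.send P)) ∧
  (∀ P, PolyTime R (ρ.recv P)) ∧ (∀ P, PolyTime R (ρ.out P)) ∧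
  ∃ q : Polynomial ℕ, ∀ P k id st m,
    (ρ.send P k id st).size ≤ q.eval (k + id.length) ∧
    (ρ.recv P k id (cons st m)).size ≤ st.size + m.size + q.eval (k + id.length)

/-- The states of the parties after `t` rounds, on inputs `x` and tapes `ω`. -/
def state (ρ : ErasingProtocol) (k : ℕ) (id : List Bool) (x ω : Party → Data) :
    ℕ → Party → Data
  | 0 => fun P => ρ.start P k id (cons (x P) (ω P))
  | t + 1 => fun P =>
      let msg : Party → Data := fun Q => ρ.send Q k id (state ρ k id x ω t Q)
      ρ.recv P k id (cons (state ρ k id x ω t P) (deliver (msg P) (msg P.other)))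

abbrev PTape (R : RingFamily) (ρ : ErasingProtocol) (k : ℕ) (id : List Bool) : Type :=
  Tape R id (ρ.coins k id) (ρ.samples k id)

end ErasingProtocol

/-- What an environment can ask for: let the execution proceed by one step, or corrupt a party. -/
inductive Request : Type
  | advance : Request
  | corrupt : Party → Request
  deriving DecidableEq

def Request.decode : Data → Request
  | nil => .advance
  | cons nil _ => .corrupt .A
  | cons (cons _ _) _ => .corrupt .B

/-- Histories of requests are lists with the latest request first. The first `T` advances are the
`T` rounds; with advance number `T + 1` the parties deliver their outputs. -/
abbrev History : Type := List Request

namespace History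

def advances (h : History) : ℕ := h.count .advance

def isCorrupt (h : History) (P : Party) : Bool := decide (Request.corrupt P ∈ h)

/-- Whether `P` has delivered its output to the environment as an honest party. -/
def delivered (T : ℕ) : History → Party → Bool
  | [], _ => false
  | .advance :: h, P =>
      delivered T h P || (decide (advances h = T) && !isCorrupt h P)
  | .corrupt _ :: h, P => delivered T h P

/-- The outputs of honest parties that the environment has seen, if `y` are the outputs. -/
def outputs (T : ℕ) (h : History) (y : Party → Data) : Data :=
  let o : Party → Data := fun P => if delivered T h P = true then cons nil (y P) else nil
  cons (o .A) (o .B)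

end History

/-- What the environment observes after the history `h` in the real execution: the current states of
the corrupt parties, and the outputs of honest parties. -/
def realWorld (ρ : ErasingProtocol) (k : ℕ) (id : List Bool) (x ω : Party → Data)
    (h : History) : Data :=
  let T := ρ.rounds k id
  let s : Party → Data := fun P =>
    if h.isCorrupt P = true then cons nil (ρ.state k id x ω (min h.advances T) P) else nil
  cons (cons (s .A) (s .B))
    (h.outputs T fun P => ρ.out P k id (ρ.state k id x ω T P))

/-- An ideal-world simulator for adaptive corruption. From its random tape and the history of the
execution so far it computes its current report on the corrupt parties. -/
structure Simulator where
  coins : ℕ → List Bool → ℕ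
  samples : ℕ → List Bool → ℕ
  report : ℕ → List Bool → Data → Data

namespace Simulator

def Efficient (R : RingFamily) (S : Simulator) : Prop :=
  PolyLength R S.coins ∧ PolyLength R S.samples ∧ PolyTime R S.report

abbrev STape (R : RingFamily) (S : Simulator) (k : ℕ) (id : List Bool) : Type :=
  Tape R id (S.coins k id) (S.samples k id)

end Simulator

/-- A request as it is seen by the simulator, which learns the input of a party and its output from
the functionality when the party is corrupted, and not before. -/
def simEvent (x z : Party → Data) : Request → Data
  | .advance => nil
  | .corrupt P => list [bit P.bit, x P, z P]

/-- What the environment observes after the history `h` in the ideal execution: the report of the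
simulator, and the outputs of honest parties, which come from the functionality. -/
def idealWorld (S : Simulator) (T : ℕ) (k : ℕ) (id : List Bool) (σ : Data) (x z : Party → Data)
    (h : History) : Data :=
  cons (S.report k id (cons σ (list (h.map (simEvent x z))))) (h.outputs T z)

/-- An environment (together with its passive adversary). It fixes the ring, chooses the inputs from
its advice and its random tape, and is then activated a number of times; in each activation it makes
a request, depending on all that it has observed so far (latest observation first).
In the end it outputs a bit. -/
structure Environment (R : RingFamily) where
  id : ℕ → List Bool
  advice : ℕ → Data
  coins : ℕ → ℕ
  samples : ℕ → ℕ
  activations : ℕ → ℕ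
  inputs : ∀ k, Tape R (id k) (coins k) (samples k) → Party → R.Carrier (id k)
  act : ℕ → List Bool → Data → Data

namespace Environment

variable {R : RingFamily}

/-- Unrestricted in the statistical setting, non-uniform polynomial time in the
computational one. -/
def Admissible (E : Environment R) : Setting → Prop
  | .statistical => True
  | .computational =>
      PolyTime R E.act ∧
      (∃ f, PolyTime R f ∧ ∀ k τ, f k (E.id k) (list [E.advice k, Tape.enc τ]) =
        cons (R.elt (E.id k) (E.inputs k τ .A)) (R.elt (E.id k) (E.inputs k τ .B))) ∧
      ∃ q : Polynomial ℕ, ∀ k,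
        (E.id k).length ≤ q.eval k ∧ (E.advice k).size ≤ q.eval k ∧
        E.coins k ≤ q.eval k ∧ E.samples k ≤ q.eval k ∧ E.activations k ≤ q.eval k

/-- The answer of the environment to a list of observations. -/
def answer (E : Environment R) (k : ℕ) (τ : Data) (obs : List Data) : Data :=
  E.act k (E.id k) (list [E.advice k, τ, list obs])

/-- The requests and observations after `n` activations, in a world `W` that answers histories with
observations. -/
def interact (E : Environment R) (k : ℕ) (τ : Data) (W : History → Data) :
    ℕ → History × List Data
  | 0 => ([], [W []])
  | n + 1 =>
      let r := interact E k τ W n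
      let h : History := Request.decode (E.answer k τ r.2) :: r.1
      (h, W h :: r.2)

/-- The final bit. -/
def verdict (E : Environment R) (k : ℕ) (τ : Data) (W : History → Data) : Data :=
  E.answer k τ (E.interact k τ W (E.activations k)).2

/-- The real execution of the protocol `ρ`. -/
def real (E : Environment R) (ρ : ErasingProtocol) (k : ℕ) : PMF Data := do
  let τ ← unif (Tape R (E.id k) (E.coins k) (E.samples k))
  let ω ← unif (Party → ρ.PTape R k (E.id k))
  pure (E.verdict k τ.enc
    (realWorld ρ k (E.id k) (fun P => R.elt _ (E.inputs k τ P)) fun P => (ω P).enc))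

/-- The ideal execution with product-sharing and the simulator `S`; honest parties give their output
after the same number `T` of rounds as in the real execution. -/
def ideal (E : Environment R) (S : Simulator) (T : ℕ → List Bool → ℕ) (k : ℕ) : PMF Data := do
  let τ ← unif (Tape R (E.id k) (E.coins k) (E.samples k))
  let z ← pdtShr R (E.id k) (E.inputs k τ .A) (E.inputs k τ .B)
  let σ ← unif (S.STape R k (E.id k))
  pure (E.verdict k τ.enc
    (idealWorld S (T k (E.id k)) k (E.id k) σ.enc (fun P => R.elt _ (E.inputs k τ P))
      fun P => R.elt _ (z P)))

end Environment

/-- `ρ` securely realizes product-sharing against adaptive passive corruption with erasures. -/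
def RealizesAdaptively (R : RingFamily) (s : Setting) (ρ : ErasingProtocol) : Prop :=
  ρ.Efficient R ∧ ∃ S : Simulator, S.Efficient R ∧
    ∀ E : Environment R, E.Admissible s →
      Negligible fun k => prTrue (E.real ρ k) - prTrue (E.ideal S ρ.rounds k)

/-! ## The transformed protocol

States: `(0, (x, (r, (ω, received))))` while `π` is run on the random input `r`;
`(1, (x, (r, s)))` after everything but the input and output `r`, `s` of `π` has been erased;
`(2, (x, (r, (s, m))))` after the correction `m` of the other party has been received. -/

namespace Derandomized

/-- The first ring element of the random tape is the random input of `π`, the rest is its tape. -/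
def start : Data → Data
  | cons x (cons c (cons r ss)) => cons (unary 0) (cons x (cons r (cons (cons c ss) nil)))
  | _ => nil

/-- Messages of `π` in its rounds, nothing in the erasure round, then the correction `x - r`. -/
def send (R : RingFamily) (π : Protocol) (P : Party) (k : ℕ) (id : List Bool) : Data → Data
  | cons nil (cons _ (cons r (cons ω rec))) =>
      if rec.len < π.rounds k id then π.next P k id (cons r (cons ω rec)) else nil
  | cons (cons nil nil) (cons x (cons r _)) => cons (R.query .sub id x r) nil
  | _ => nil

def recv (π : Protocol) (P : Party) (k : ℕ) (id : List Bool) : Data → Data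
  | cons (cons nil (cons x (cons r (cons ω rec)))) m =>
      if rec.len < π.rounds k id then
        cons (unary 0) (cons x (cons r (cons ω (cons m rec))))
      else cons (unary 1) (cons x (cons r (π.out P k id (cons r (cons ω rec)))))
  | cons (cons (cons nil nil) (cons x (cons r s))) m =>
      cons (unary 2) (cons x (cons r (cons s m.fst)))
  | cons st _ => st
  | nil => nil

/-- `A` outputs `x * m + s`, and `B` outputs `m * r + s`. -/
def out (R : RingFamily) (P : Party) (id : List Bool) : Data → Data
  | cons _ (cons x (cons r (cons s m))) =>
      match P with
      | .A => R.query .add id (R.query .mul id x m) s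
      | .B => R.query .add id (R.query .mul id m r) s
  | _ => nil

end Derandomized

/-- The protocol that runs `π` on random inputs, erases, and sends corrections. -/
def derandomized (R : RingFamily) (π : Protocol) : ErasingProtocol where
  rounds k id := π.rounds k id + 2
  coins := π.coins
  samples k id := π.samples k id + 1
  start _ _ _ := Derandomized.start
  send := Derandomized.send R π
  recv := Derandomized.recv π
  out P _ id := Derandomized.out R P id

end ProdShare

end

/-!
The protocol runs `π` on random inputs `r A`, `r B`, keeps only the shares `s A`, `s B` of
`r A * r B`, and turns them into shares of `x A * x B` with the corrections `x A - r A` and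
`x B - r B`.

The simulator (`adaptiveSim`) acts when the first party `P` is corrupted. It learns the input `x` and
the output `z` of `P`, and picks uniformly the random input of `P` and the correction `m` that `P`
receives. These determine the share `s` of `P`, namely `z` minus `x * m` (for `A`) or `m * r`
(for `B`), and the special simulator of `π` supplies a run in which `P` has input `r` and
output `s`. With the inputs of the parties fixed, this is a change of variables: the random inputs of
both parties and the share of `P` become uniform and independent, and the two shares add up to
`r A * r B` exactly if the two outputs add up to `x A * x B` (`avg_reparametrize`,
`sub_correctionTerm_other`).

Two cases remain for each `P`. If the other party is corrupted before the erasure, the environment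
sees a complete run and never an output of an honest party; what it sees is a function of the
inputs and tapes of this run, which are indistinguishable from uniform ones (`negligible_early`).
Otherwise it sees, besides the shares, only the view of `P`, and the second property of the special
simulator applies, up to the probability that this simulator aborts, which is negligible since
real runs do not abort (`negligible_late`, `negligible_abort`). Both the party that is corrupted first
and the case are determined by the history, and it suffices to compare the probabilities that the
environment accepts with a history of a given class; worlds that agree along the histories of a
class are equivalent there (`Environment.accepts_congr`). All worlds are written in terms of two
`profile`s, so that one distinguisher (`classDistinguisher`), which simulates the environment in a
world of given profiles, serves all reductions.

That the simulator and the distinguishers run in polynomial time is shown with closure properties of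
`PolyTime`, mainly for composition and for loops whose states stay polynomially large
(`PolyTime.comp`, `PolyTime.loop`).
-/

noncomputable section

namespace ProdShare

open Data

/-! ### Polynomial bounds and polynomial-time functions -/
section Polynomials

namespace Data

@[simp] theorem fst_nil : nil.fst = nil := rfl
@[simp] theorem snd_nil : nil.snd = nil := rfl
@[simp] theorem fst_cons (a b : Data) : (cons a b).fst = a := rfl
@[simp] theorem snd_cons (a b : Data) : (cons a b).snd = b := rfl
@[simp] theorem toBool_nil : nil.toBool = false := rfl
@[simp] theorem toBool_cons (a b : Data) : (cons a b).toBool = true := rfl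

theorem size_pos (d : Data) : 0 < d.size := by cases d <;> simp only [size] <;> omega

theorem size_fst_add_size_snd_le (d : Data) : d.fst.size + d.snd.size ≤ d.size + 1 := by
  cases d <;> simp only [size, fst, snd] <;> omega

theorem size_fst_le (d : Data) : d.fst.size ≤ d.size := by
  cases d <;> simp [size, fst]; omega

theorem size_snd_le (d : Data) : d.snd.size ≤ d.size := by
  cases d <;> simp [size, snd]

theorem len_le_size (d : Data) : d.len ≤ d.size := by
  induction d with
  | nil => simp [len]
  | cons a b _ ih => simp only [len, size]; omega

theorem unary_succ (n : ℕ) : unary (n + 1) = cons nil (unary n) := rfl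

@[simp] theorem len_unary (n : ℕ) : (unary n).len = n := by
  induction n with
  | zero => rfl
  | succ n ih => rw [unary_succ, len, ih]

@[simp] theorem size_unary (n : ℕ) : (unary n).size = 2 * n + 1 := by
  induction n with
  | zero => rfl
  | succ n ih => rw [unary_succ, size, size, ih]; ring

theorem bits_cons (b : Bool) (l : List Bool) : bits (b :: l) = cons (bit b) (bits l) := rfl

theorem two_mul_length_lt_size_bits (l : List Bool) : 2 * l.length < (bits l).size := by
  induction l with
  | nil => simp [bits, list, size]
  | cons b l ih =>
    have := size_pos (bit b)
    rw [bits_cons, size, List.length_cons]; omega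

theorem size_bits_le (l : List Bool) : (bits l).size ≤ 4 * l.length + 1 := by
  induction l with
  | nil => simp [bits, list, size]
  | cons b l ih =>
    have : (bit b).size ≤ 3 := by cases b <;> simp [bit, size]
    rw [bits_cons, size, List.length_cons]; omega

@[simp] theorem toBool_bit (b : Bool) : (bit b).toBool = b := by cases b <;> rfl

end Data

theorem RingFamily.size_elt_le (R : RingFamily) (id : List Bool) (x : R.Carrier id) :
    (R.elt id x).size ≤ 4 * id.length + 1 := by
  rw [← R.label_length id x]; exact size_bits_le _

theorem RingFamily.size_query_le (R : RingFamily) (op : RingOp) (id : List Bool) (u v : Data) :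
    (R.query op id u v).size ≤ 4 * id.length + 1 := by
  unfold RingFamily.query
  split
  · exact R.size_elt_le id _
  · simp [size]

theorem eval_le_eval (q : Polynomial ℕ) {m n : ℕ} (h : m ≤ n) : q.eval m ≤ q.eval n := by
  rw [Polynomial.eval_eq_sum_range, Polynomial.eval_eq_sum_range]
  exact Finset.sum_le_sum fun i _ => Nat.mul_le_mul_left _ (Nat.pow_le_pow_left h i)

/-- The input of a program for the data item `x`, with the security parameter and the ring name. -/
def inp (k : ℕ) (id : List Bool) (x : Data) : Data := cons (unary k) (cons (bits id) x)

theorem size_inp (k : ℕ) (id : List Bool) (x : Data) :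
    (inp k id x).size = 2 * k + (bits id).size + x.size + 3 := by
  simp only [inp, size, size_unary]; omega

/-- Numbers that are polynomially bounded in the length of the input of a program. -/
def PolyBdd (b : ℕ → List Bool → Data → ℕ) : Prop :=
  ∃ q : Polynomial ℕ, ∀ k id x, b k id x ≤ q.eval (inp k id x).size

namespace PolyBdd

variable {b c : ℕ → List Bool → Data → ℕ}

theorem mono (hc : PolyBdd c) (h : ∀ k id x, b k id x ≤ c k id x) : PolyBdd b :=
  let ⟨q, hq⟩ := hc
  ⟨q, fun k id x => (h k id x).trans (hq k id x)⟩

theorem const (n : ℕ) : PolyBdd fun _ _ _ => n := ⟨.C n, fun _ _ _ => by simp⟩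

theorem size_inp : PolyBdd fun k id x => (inp k id x).size := ⟨.X, fun _ _ _ => by simp⟩

theorem add (hb : PolyBdd b) (hc : PolyBdd c) : PolyBdd fun k id x => b k id x + c k id x :=
  let ⟨q, hq⟩ := hb
  let ⟨r, hr⟩ := hc
  ⟨q + r, fun k id x => by rw [Polynomial.eval_add]; exact Nat.add_le_add (hq k id x) (hr k id x)⟩

theorem mul (hb : PolyBdd b) (hc : PolyBdd c) : PolyBdd fun k id x => b k id x * c k id x :=
  let ⟨q, hq⟩ := hb
  let ⟨r, hr⟩ := hc
  ⟨q * r, fun k id x => by rw [Polynomial.eval_mul]; exact Nat.mul_le_mul (hq k id x) (hr k id x)⟩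

theorem eval (q : Polynomial ℕ) (hb : PolyBdd b) : PolyBdd fun k id x => q.eval (b k id x) :=
  let ⟨r, hr⟩ := hb
  ⟨q.comp r, fun k id x => by rw [Polynomial.eval_comp]; exact eval_le_eval q (hr k id x)⟩

theorem comp (hb : PolyBdd b) {f : ℕ → List Bool → Data → Data}
    (hf : PolyBdd fun k id x => (f k id x).size) : PolyBdd fun k id x => b k id (f k id x) :=
  let ⟨q, hq⟩ := hb
  (eval q (size_inp.add hf)).mono fun k id x => (hq k id _).trans <| eval_le_eval q <| by
    rw [ProdShare.size_inp, ProdShare.size_inp]; omega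

end PolyBdd

/-- Programs are charged for what they write. -/
theorem Prog.size_run_le_cost (R : RingFamily) (p : Prog) (x : Data) :
    (p.run R x).size ≤ p.cost R x := by
  induction p generalizing x with
  | ident => simp [run, cost]
  | nil => simp [run, cost, size]
  | fst => have := size_fst_le x; simp only [run, cost]; omega
  | snd => have := size_snd_le x; simp only [run, cost]; omega
  | pair p q hp hq => have := hp x; have := hq x; simp only [run, cost, size]; omega
  | comp q p hq hp => have := hq (p.run R x); simp only [run, cost]; omega
  | cond p q r hp hq hr =>
    have := hq x; have := hr x
    simp only [run, cost]; split_ifs <;> omega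
  | iter p hp =>
    obtain ⟨n, hn⟩ := Nat.exists_eq_succ_of_ne_zero (size_pos x.fst).ne'
    have := hp ((run R p)^[n] x.snd)
    simp only [run, cost, hn, Finset.sum_range_succ, Function.iterate_succ_apply']
    omega
  | ring op => simp only [run, cost]; omega
  | one => simp only [run, cost]; omega
  | invert => simp only [run, cost]; omega

variable {R : RingFamily}

theorem polyTime_iff {f : ℕ → List Bool → Data → Data} : PolyTime R f ↔
    ∃ p : Prog, (∀ k id x, p.run R (inp k id x) = f k id x) ∧
      PolyBdd fun k id x => p.cost R (inp k id x) := by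
  constructor
  · rintro ⟨p, q, h⟩
    exact ⟨p, fun k id x => (h k id x).1, q, fun k id x => (h k id x).2⟩
  · rintro ⟨p, h, q, hq⟩
    exact ⟨p, q, fun k id x => ⟨h k id x, hq k id x⟩⟩

namespace PolyTime

variable {f g h : ℕ → List Bool → Data → Data}

theorem size (hf : PolyTime R f) : PolyBdd fun k id x => (f k id x).size := by
  obtain ⟨p, hp, hq⟩ := polyTime_iff.1 hf
  exact hq.mono fun k id x => by rw [← hp]; exact p.size_run_le_cost R _

theorem cons (hf : PolyTime R f) (hg : PolyTime R g) :
    PolyTime R fun k id x => cons (f k id x) (g k id x) := by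
  obtain ⟨p, hp, hp'⟩ := polyTime_iff.1 hf
  obtain ⟨q, hq, hq'⟩ := polyTime_iff.1 hg
  refine polyTime_iff.2 ⟨p.pair q, fun k id x => by simp [Prog.run, hp, hq], ?_⟩
  exact (((PolyBdd.const 1).add PolyBdd.size_inp).add hp').add hq'

/-- The program that applies `p` and keeps the security parameter and the ring name. -/
def withInp (p : Prog) : Prog := .pair .fst (.pair (.comp .fst .snd) p)

theorem run_withInp (p : Prog) (k : ℕ) (id : List Bool) (x : Data) :
    (withInp p).run R (inp k id x) = inp k id (p.run R (inp k id x)) := rfl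

theorem cost_withInp_le (p : Prog) (k : ℕ) (id : List Bool) (x : Data) :
    (withInp p).cost R (inp k id x) ≤ 6 + 5 * (inp k id x).size + p.cost R (inp k id x) := by
  have := size_snd_le (inp k id x)
  simp only [withInp, Prog.cost, Prog.run]
  omega

theorem comp (hg : PolyTime R g) (hf : PolyTime R f) :
    PolyTime R fun k id x => g k id (f k id x) := by
  obtain ⟨p, hp, hp'⟩ := polyTime_iff.1 hf
  obtain ⟨q, hq, hq'⟩ := polyTime_iff.1 hg
  refine polyTime_iff.2 ⟨q.comp (withInp p), fun k id x => ?_, ?_⟩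
  · rw [Prog.run, run_withInp, hp, hq]
  · refine (((PolyBdd.const 7).add ((PolyBdd.const 5).mul PolyBdd.size_inp)).add hp').add
      (hq'.comp hf.size) |>.mono fun k id x => ?_
    have := cost_withInp_le (R := R) p k id x
    rw [Prog.cost, run_withInp, hp]
    omega

theorem of_prog {p : Prog} (c : ℕ) (hp : ∀ k id x, p.run R (inp k id x) = f k id x)
    (hc : ∀ k id x, p.cost R (inp k id x) ≤ c * (1 + (inp k id x).size)) : PolyTime R f :=
  polyTime_iff.2 ⟨p, hp, ((PolyBdd.const c).mul ((PolyBdd.const 1).add PolyBdd.size_inp)).mono hc⟩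

theorem arg : PolyTime R fun _ _ x => x :=
  of_prog (p := .comp .snd .snd) 3 (fun _ _ _ => rfl) fun k id x => by
    have := size_snd_le (inp k id x)
    simp only [Prog.cost, Prog.run]; omega

theorem nil : PolyTime R fun _ _ _ => nil :=
  of_prog (p := .nil) 1 (fun _ _ _ => rfl) fun k id x => by simp [Prog.cost]

theorem security : PolyTime R fun k _ _ => unary k :=
  of_prog (p := .fst) 1 (fun _ _ _ => rfl) fun k id x => by simp [Prog.cost]

theorem name : PolyTime R fun _ id _ => bits id :=
  of_prog (p := .comp .fst .snd) 3 (fun _ _ _ => rfl) fun k id x => by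
    have := size_snd_le (inp k id x)
    simp only [Prog.cost, Prog.run]; omega

theorem fst_arg : PolyTime R fun _ _ x => x.fst :=
  of_prog (p := .comp .fst (.comp .snd .snd)) 10 (fun _ _ _ => rfl) fun k id x => by
    have := size_snd_le (inp k id x)
    have := size_snd_le (inp k id x).snd
    simp only [Prog.cost, Prog.run]; omega

theorem snd_arg : PolyTime R fun _ _ x => x.snd :=
  of_prog (p := .comp .snd (.comp .snd .snd)) 10 (fun _ _ _ => rfl) fun k id x => by
    have := size_snd_le (inp k id x)
    have := size_snd_le (inp k id x).snd
    simp only [Prog.cost, Prog.run]; omega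

theorem fst (hf : PolyTime R f) : PolyTime R fun k id x => (f k id x).fst := fst_arg.comp hf

theorem snd (hf : PolyTime R f) : PolyTime R fun k id x => (f k id x).snd := snd_arg.comp hf

theorem const (d : Data) : PolyTime R fun _ _ _ => d := by
  induction d with
  | nil => exact nil
  | cons a b ha hb => exact ha.cons hb

theorem ite (hf : PolyTime R f) (hg : PolyTime R g) (hh : PolyTime R h) :
    PolyTime R fun k id x => if (f k id x).toBool = true then g k id x else h k id x := by
  obtain ⟨p, hp, hp'⟩ := polyTime_iff.1 hf
  obtain ⟨q, hq, hq'⟩ := polyTime_iff.1 hg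
  obtain ⟨r, hr, hr'⟩ := polyTime_iff.1 hh
  refine polyTime_iff.2 ⟨.cond p q r, fun k id x => by simp [Prog.run, hp, hq, hr], ?_⟩
  refine ((((PolyBdd.const 1).add PolyBdd.size_inp).add hp').add (hq'.add hr')).mono
    fun k id x => ?_
  simp only [Prog.cost]
  split_ifs <;> omega

theorem query (op : RingOp) (hf : PolyTime R f) (hg : PolyTime R g) :
    PolyTime R fun k id x => R.query op id (f k id x) (g k id x) := by
  have key : PolyTime R fun _ id x => R.query op id x.fst x.snd := by
    refine polyTime_iff.2 ⟨.comp (.ring op) .snd, fun k id x => ?_, ?_⟩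
    · simp [Prog.run, Prog.callRing, inp, Data.fst, Data.snd, decBits_bits]
    · refine ((PolyBdd.const 4).add ((PolyBdd.const 10).mul PolyBdd.size_inp)).mono
        fun k id x => ?_
      have h1 := R.size_query_le op id x.fst x.snd
      have h2 := two_mul_length_lt_size_bits id
      have h3 := size_snd_le (inp k id x)
      have h4 := size_inp k id x
      have h5 : Prog.callRing R op (inp k id x).snd = R.query op id x.fst x.snd := by
        simp [Prog.callRing, inp, Data.fst, Data.snd, decBits_bits]
      simp only [Prog.cost, Prog.run, h5]
      omega
  exact key.comp (hf.cons hg)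

theorem iterate (hf : PolyTime R f) (hg : PolyTime R g) (hh : PolyTime R h)
    (hb : ∃ q : Polynomial ℕ, ∀ k id x i,
      ((f k id)^[i] (h k id x)).size ≤ q.eval ((inp k id x).size + i)) :
    PolyTime R fun k id x => (f k id)^[(g k id x).size] (h k id x) := by
  obtain ⟨p, hp, qp, hqp⟩ := polyTime_iff.1 hf
  obtain ⟨q, hq⟩ := hb
  have hrun (k : ℕ) (id : List Bool) (i : ℕ) (y : Data) :
      ((withInp p).run R)^[i] (inp k id y) = inp k id ((f k id)^[i] y) := by
    induction i with
    | zero => rfl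
    | succ i ih => rw [Function.iterate_succ_apply', ih, run_withInp, hp,
        Function.iterate_succ_apply']
  have hstart : PolyTime R fun k id x => Data.cons (g k id x) (inp k id (h k id x)) :=
    hg.cons (security.cons (name.cons hh))
  obtain ⟨s, hs, hs'⟩ := polyTime_iff.1 hstart
  refine polyTime_iff.2 ⟨.comp (.comp .snd .snd) (.comp (.iter (withInp p)) s), fun k id x => ?_, ?_⟩
  · simp only [Prog.run, hs, Data.fst, Data.snd, hrun]
    rfl
  · -- the size of every loop state, and the cost of every pass through the body
    let m : ℕ → List Bool → Data → ℕ := fun k id x =>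
      (inp k id x).size + q.eval ((inp k id x).size + (g k id x).size)
    have hm : PolyBdd m :=
      PolyBdd.size_inp.add (PolyBdd.eval q (PolyBdd.size_inp.add hg.size))
    have hstate (k : ℕ) (id : List Bool) (x : Data) (i : ℕ) (hi : i ≤ (g k id x).size) :
        (inp k id ((f k id)^[i] (h k id x))).size ≤ m k id x := by
      have := (hq k id x i).trans (eval_le_eval q (Nat.add_le_add_left hi _))
      simp only [m, size_inp] at this ⊢
      omega
    let c : ℕ → List Bool → Data → ℕ := fun k id x => 6 + 5 * m k id x + qp.eval (m k id x)
    have hc : PolyBdd c :=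
      ((PolyBdd.const 6).add ((PolyBdd.const 5).mul hm)).add (PolyBdd.eval qp hm)
    refine ((((PolyBdd.const 10).add ((PolyBdd.const 3).mul hs')).add
      (hg.size.mul hc)).add ((PolyBdd.const 2).mul hm)).mono fun k id x => ?_
    have h1 : ∑ i ∈ Finset.range (g k id x).size,
        (withInp p).cost R (inp k id ((f k id)^[i] (h k id x))) ≤ (g k id x).size * c k id x := by
      rw [← smul_eq_mul, ← Finset.card_range (g k id x).size, ← Finset.sum_const,
        Finset.card_range]
      refine Finset.sum_le_sum fun i hi => ?_
      have h2 := hstate k id x i (Finset.mem_range.1 hi).le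
      have h3 := cost_withInp_le (R := R) p k id ((f k id)^[i] (h k id x))
      have h4 := hqp k id ((f k id)^[i] (h k id x))
      have h5 := eval_le_eval qp h2
      simp only [c] at h4 ⊢
      omega
    have h2 := hstate k id x _ le_rfl
    have h3 := s.size_run_le_cost R (inp k id x)
    have h4 := size_snd_le (inp k id ((f k id)^[(g k id x).size] (h k id x)))
    rw [hs] at h3
    simp only [Prog.cost, Prog.run, hs, Data.fst, Data.snd, hrun] at h1 h2 h3 ⊢
    simp only [inp, Data.snd] at h1 h2 h3 h4 ⊢
    omega

end PolyTime

namespace Data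

/-- One pass through the body `f` of a loop that is controlled by the length of a list. -/
def countdown (f : Data → Data) (d : Data) : Data :=
  if d.fst.toBool = true then cons d.fst.snd (f d.snd) else cons d.fst d.snd

theorem iterate_countdown (f : Data → Data) (i : ℕ) (c s : Data) :
    (countdown f)^[i] (cons c s) = cons (snd^[i] c) (f^[min i c.len] s) := by
  induction i generalizing c s with
  | zero => simp
  | succ i ih =>
    rw [Function.iterate_succ_apply]
    cases c with
    | nil => simp [countdown, fst, snd, toBool, ih, len]
    | cons a b =>
      have h : min (i + 1) (b.len + 1) = min i b.len + 1 := by omega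
      rw [len, h, Function.iterate_succ_apply]
      simp [countdown, fst, snd, toBool, ih]

theorem size_iterate_snd_le (i : ℕ) (d : Data) : (snd^[i] d).size ≤ d.size := by
  induction i with
  | zero => simp
  | succ i ih => rw [Function.iterate_succ_apply']; exact (size_snd_le _).trans ih

end Data

/-- Loops of polynomially many rounds are polynomial time if their states stay polynomially
large. -/
theorem PolyTime.loop {f g h : ℕ → List Bool → Data → Data} (hf : PolyTime R f)
    (hg : PolyTime R g) (hh : PolyTime R h)
    (hb : ∃ q : Polynomial ℕ, ∀ k id x i,
      ((f k id)^[i] (h k id x)).size ≤ q.eval ((inp k id x).size + i)) :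
    PolyTime R fun k id x => (f k id)^[(g k id x).len] (h k id x) := by
  have hbody : PolyTime R fun k id => countdown (f k id) :=
    (fst arg).ite ((snd (fst arg)).cons (hf.comp (snd arg))) ((fst arg).cons (snd arg))
  obtain ⟨q, hq⟩ := hb
  obtain ⟨r, hr⟩ := hg.size
  have hmain := (hbody.iterate hg (hg.cons hh) ⟨1 + r + q, fun k id x i => ?_⟩).snd
  · refine (congrArg (PolyTime R) ?_).mp hmain
    funext k id x
    rw [iterate_countdown, Data.snd, min_eq_right (len_le_size _)]
  · rw [iterate_countdown, Data.size]
    have h1 := size_iterate_snd_le i (g k id x)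
    have h2 := (hq k id x (min i (g k id x).len)).trans
      (eval_le_eval q (Nat.add_le_add_left (min_le_left _ _) _))
    have h3 := (hr k id x).trans (eval_le_eval r (Nat.le_add_right _ i))
    simp only [Polynomial.eval_add, Polynomial.eval_one] at h3 ⊢
    omega

end Polynomials

/-! ### Efficiency of the derandomized protocol -/
section Efficiency

variable {R : RingFamily}

namespace Data

theorem toBool_iterate_snd (n : ℕ) (d : Data) : (snd^[n] d).toBool = decide (n < d.len) := by
  induction n generalizing d with
  | zero => cases d <;> simp [toBool, len]
  | succ n ih => cases d <;> simp [Function.iterate_succ_apply, snd, ih, len]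

end Data

theorem PolyLength.succ {n : ℕ → List Bool → ℕ} (hn : PolyLength R n) :
    PolyLength R fun k id => n k id + 1 :=
  PolyTime.nil.cons hn

namespace PolyTime

variable {f g h : ℕ → List Bool → Data → Data}

theorem drop (hf : PolyTime R f) (hg : PolyTime R g) :
    PolyTime R fun k id x => Data.snd^[(f k id x).len] (g k id x) := by
  obtain ⟨q, hq⟩ := hg.size
  exact snd_arg.loop hf hg ⟨q, fun k id x i => (size_iterate_snd_le _ _).trans
    ((hq k id x).trans (eval_le_eval q (Nat.le_add_right _ _)))⟩

theorem ite_len_lt {n : ℕ → List Bool → ℕ} {e : ℕ → List Bool → Data → Data}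
    (he : PolyTime R e) (hn : PolyLength R n) (hg : PolyTime R g) (hh : PolyTime R h) :
    PolyTime R fun k id x => if (e k id x).len < n k id then g k id x else h k id x := by
  refine (congrArg (PolyTime R) ?_).mp ((drop he hn).ite hg hh)
  funext k id x
  simp [toBool_iterate_snd]

end PolyTime

open PolyTime

theorem Derandomized.polyTime_start : PolyTime R fun _ _ => Derandomized.start := by
  have h : PolyTime R fun _ _ d =>
      if d.toBool = true then
        if d.snd.toBool = true then
          if d.snd.snd.toBool = true then
            cons (unary 0) (cons d.fst (cons d.snd.snd.fst
              (cons (cons d.snd.fst d.snd.snd.snd) Data.nil)))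
          else Data.nil
        else Data.nil
      else Data.nil := by
    repeat first
      | exact const _
      | exact arg
      | apply PolyTime.ite
      | apply PolyTime.cons
      | apply PolyTime.fst
      | apply PolyTime.snd
  refine (congrArg (PolyTime R) ?_).mp h
  funext k id d
  rcases d with _ | ⟨x, _ | ⟨c, _ | ⟨r, ss⟩⟩⟩ <;> simp [start]

variable {π : Protocol}

theorem Derandomized.polyTime_send (hπ : π.Efficient R) (P : Party) :
    PolyTime R (Derandomized.send R π P) := by
  have h : PolyTime R fun k id d =>
      if d.toBool = true then
        if d.fst.toBool = true then
          if d.fst.fst.toBool = true then Data.nil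
          else if d.fst.snd.toBool = true then Data.nil
          else if d.snd.toBool = true then
            if d.snd.snd.toBool = true then
              cons (R.query .sub id d.snd.fst d.snd.snd.fst) Data.nil
            else Data.nil
          else Data.nil
        else if d.snd.toBool = true then
          if d.snd.snd.toBool = true then
            if d.snd.snd.snd.toBool = true then
              if d.snd.snd.snd.snd.len < π.rounds k id then π.next P k id d.snd.snd
              else Data.nil
            else Data.nil
          else Data.nil
        else Data.nil
      else Data.nil := by
    repeat first
      | exact const _
      | exact arg
      | exact hπ.1
      | apply PolyTime.ite
      | apply PolyTime.ite_len_lt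
      | apply PolyTime.cons
      | apply PolyTime.query
      | apply (hπ.2.2.2.1 P).comp
      | apply PolyTime.fst
      | apply PolyTime.snd
  refine (congrArg (PolyTime R) ?_).mp h
  funext k id d
  rcases d with _ | ⟨_ | ⟨_ | _, _ | _⟩, _ | ⟨x, _ | ⟨r, _ | ⟨ω, rec⟩⟩⟩⟩ <;>
    simp [send]
  rfl

theorem Derandomized.polyTime_recv (hπ : π.Efficient R) (P : Party) :
    PolyTime R (Derandomized.recv π P) := by
  have h : PolyTime R fun k id y =>
      if y.toBool = true then
        if y.fst.toBool = true then
          if y.fst.fst.toBool = true then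
            if y.fst.fst.fst.toBool = true then y.fst
            else if y.fst.fst.snd.toBool = true then y.fst
            else if y.fst.snd.toBool = true then
              if y.fst.snd.snd.toBool = true then
                cons (unary 2) (cons y.fst.snd.fst (cons y.fst.snd.snd.fst
                  (cons y.fst.snd.snd.snd y.snd.fst)))
              else y.fst
            else y.fst
          else if y.fst.snd.toBool = true then
            if y.fst.snd.snd.toBool = true then
              if y.fst.snd.snd.snd.toBool = true then
                if y.fst.snd.snd.snd.snd.len < π.rounds k id then
                  cons (unary 0) (cons y.fst.snd.fst (cons y.fst.snd.snd.fst
                    (cons y.fst.snd.snd.snd.fst (cons y.snd y.fst.snd.snd.snd.snd))))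
                else cons (unary 1) (cons y.fst.snd.fst (cons y.fst.snd.snd.fst
                  (π.out P k id y.fst.snd.snd)))
              else y.fst
            else y.fst
          else y.fst
        else y.fst
      else Data.nil := by
    repeat first
      | exact const _
      | exact arg
      | exact hπ.1
      | apply PolyTime.ite
      | apply PolyTime.ite_len_lt
      | apply PolyTime.cons
      | apply (hπ.2.2.2.2.1 P).comp
      | apply PolyTime.fst
      | apply PolyTime.snd
  refine (congrArg (PolyTime R) ?_).mp h
  funext k id d
  rcases d with _ | ⟨_ | ⟨_ | ⟨_ | _, _ | _⟩, _ | ⟨x, _ | ⟨r, _ | ⟨ω, rec⟩⟩⟩⟩, m⟩ <;>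
    simp [recv]
  rfl

theorem Derandomized.polyTime_out (P : Party) :
    PolyTime R fun _ id => Derandomized.out R P id := by
  have h : PolyTime R fun _ id d =>
      if d.toBool = true then
        if d.snd.toBool = true then
          if d.snd.snd.toBool = true then
            if d.snd.snd.snd.toBool = true then
              R.query .add id
                (R.query .mul id
                  (match P with | .A => d.snd.fst | .B => d.snd.snd.snd.snd)
                  (match P with | .A => d.snd.snd.snd.snd | .B => d.snd.snd.fst))
                d.snd.snd.snd.fst
            else Data.nil
          else Data.nil
        else Data.nil
      else Data.nil := by
    cases P <;>
    repeat first
      | exact const _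
      | exact arg
      | apply PolyTime.ite
      | apply PolyTime.query
      | apply PolyTime.fst
      | apply PolyTime.snd
  refine (congrArg (PolyTime R) ?_).mp h
  funext k id d
  rcases d with _ | ⟨_, _ | ⟨x, _ | ⟨r, _ | ⟨s, m⟩⟩⟩⟩ <;> cases P <;>
    simp [out]

theorem Derandomized.size_send_le {q : Polynomial ℕ}
    (hq : ∀ P k id v, (π.next P k id v).size ≤ q.eval (k + id.length))
    (P : Party) (k : ℕ) (id : List Bool) (st : Data) :
    (Derandomized.send R π P k id st).size ≤ q.eval (k + id.length) + 4 * (k + id.length) + 3 := by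
  unfold send
  split
  · split_ifs
    · have := hq P k id; grind
    · simp [Data.size]
  · rename_i x r _
    have := R.size_query_le .sub id x r
    simp only [Data.size]; omega
  · simp [Data.size]

theorem Derandomized.size_recv_le {q : Polynomial ℕ}
    (hq : ∀ P k id v, (π.out P k id v).size ≤ q.eval (k + id.length))
    (P : Party) (k : ℕ) (id : List Bool) (st m : Data) :
    (Derandomized.recv π P k id (cons st m)).size ≤
      st.size + m.size + (q.eval (k + id.length) + 5) := by
  unfold recv
  split
  · rename_i x r ω rec m' heq
    cases heq
    split_ifs
    · simp only [Data.size, size_unary]; omega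
    · have := hq P k id (cons r (cons ω rec))
      simp only [Data.size, size_unary]; omega
  · rename_i x r s m' heq
    cases heq
    have := size_fst_le m
    simp only [Data.size, size_unary]; omega
  · rename_i heq
    cases heq
    omega
  · rename_i heq
    cases heq

theorem derandomized_efficient (hπ : π.Efficient R) : (derandomized R π).Efficient R := by
  have ⟨hr, hc, hs, hn, ho, q, hq⟩ := hπ
  refine ⟨hr.succ.succ, hc, hs.succ, fun _ => Derandomized.polyTime_start,
    Derandomized.polyTime_send hπ, Derandomized.polyTime_recv hπ, Derandomized.polyTime_out,
    q + 4 * .X + 5, fun P k id st m => ?_⟩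
  have h1 := Derandomized.size_send_le (R := R) (fun P k id v => (hq P k id v).1) P k id st
  have h2 := Derandomized.size_recv_le (fun P k id v => (hq P k id v).2) P k id st m
  simp only [Polynomial.eval_add, Polynomial.eval_mul, Polynomial.eval_X, Polynomial.eval_ofNat]
  exact ⟨h1.trans (by omega), h2.trans (by omega)⟩

end Efficiency

/-! ### Histories of corruptions -/
section Histories

variable {R : RingFamily}

namespace History

/-- Whether `B` was corrupted before `A`. -/
def firstB : History → Bool
  | [] => false
  | r :: h => firstB h || (decide (r = .corrupt .B) && !isCorrupt h .A)

/-- Whether at some time during the first `T` rounds both parties were corrupt. -/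
def early (T : ℕ) : History → Bool
  | [] => false
  | r :: h => early T h ||
      (isCorrupt (r :: h) .A && isCorrupt (r :: h) .B && decide (advances (r :: h) ≤ T))

@[simp] theorem advances_advance (h : History) : advances (.advance :: h) = advances h + 1 := by
  simp [advances]

@[simp] theorem advances_corrupt (P : Party) (h : History) :
    advances (.corrupt P :: h) = advances h := by
  simp [advances]

@[simp] theorem isCorrupt_nil (P : Party) : isCorrupt [] P = false := rfl

@[simp] theorem isCorrupt_advance (P : Party) (h : History) :
    isCorrupt (.advance :: h) P = isCorrupt h P := by
  simp [isCorrupt]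

@[simp] theorem isCorrupt_corrupt (P Q : Party) (h : History) :
    isCorrupt (.corrupt Q :: h) P = (decide (P = Q) || isCorrupt h P) := by
  simp [isCorrupt]

variable {T : ℕ} {h h' : History}

theorem advances_le_cons (r : Request) (h : History) : advances h ≤ advances (r :: h) := by
  cases r <;> simp

theorem isCorrupt_cons {P : Party} (r : Request) (hP : isCorrupt h P = true) :
    isCorrupt (r :: h) P = true := by
  cases r <;> simp [hP]

theorem isCorrupt_mono {P : Party} (hs : h <:+ h') (hP : isCorrupt h P = true) :
    isCorrupt h' P = true := by
  simp only [isCorrupt, decide_eq_true_eq] at hP ⊢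
  exact hs.subset hP

theorem early_of_isCorrupt (hA : isCorrupt h .A = true) (hB : isCorrupt h .B = true)
    (hT : advances h ≤ T) : early T h = true := by
  cases h with
  | nil => simp at hA
  | cons r h => simp [early, hA, hB, hT]

theorem isCorrupt_of_early (he : early T h = true) (P : Party) : isCorrupt h P = true := by
  induction h with
  | nil => simp [early] at he
  | cons r h ih =>
    simp only [early, Bool.or_eq_true, Bool.and_eq_true] at he
    rcases he with he | ⟨⟨hA, hB⟩, -⟩
    · exact isCorrupt_cons r (ih he)
    · cases P <;> assumption

theorem advances_mono (hs : h <:+ h') : advances h ≤ advances h' := by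
  induction h' with
  | nil => rw [List.suffix_nil.1 hs]
  | cons r h' ih =>
    rcases List.suffix_cons_iff.1 hs with rfl | hs
    · rfl
    · exact (ih hs).trans (advances_le_cons r h')

theorem early_mono (hs : h <:+ h') (he : early T h = true) : early T h' = true := by
  induction h' with
  | nil => rwa [List.suffix_nil.1 hs] at he
  | cons r h' ih =>
    rcases List.suffix_cons_iff.1 hs with rfl | hs
    · exact he
    · simp [early, ih hs]

/-- Whether both parties were corrupt during the first `T` rounds is known after these rounds. -/
theorem early_of_suffix (hs : h <:+ h') (he : early T h' = true) (hT : T < advances h) :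
    early T h = true := by
  induction h' with
  | nil => rwa [List.suffix_nil.1 hs]
  | cons r h' ih =>
    have hle := advances_mono hs
    rcases List.suffix_cons_iff.1 hs with rfl | hs
    · exact he
    · simp only [early, Bool.or_eq_true, Bool.and_eq_true, decide_eq_true_eq] at he
      rcases he with he | ⟨-, he⟩
      · exact ih hs he
      · omega

theorem advances_of_delivered {P : Party} (hd : delivered T h P = true) : T < advances h := by
  induction h with
  | nil => simp [delivered] at hd
  | cons r h ih =>
    cases r with
    | advance =>
      simp only [delivered, Bool.or_eq_true, Bool.and_eq_true, decide_eq_true_eq] at hd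
      rw [advances_advance]
      rcases hd with hd | hd
      · exact (ih hd).trans (Nat.lt_succ_self _)
      · omega
    | corrupt Q => rw [advances_corrupt]; exact ih hd

/-- Parties that are both corrupt early do not deliver outputs. -/
theorem delivered_eq_false_of_early {P : Party} (he : early T h = true) :
    delivered (T + 2) h P = false := by
  induction h with
  | nil => rfl
  | cons r h ih =>
    by_contra hd
    rw [Bool.not_eq_false] at hd
    have hT := advances_of_delivered hd
    have he' : early T h = true := by
      simp only [early, Bool.or_eq_true, Bool.and_eq_true, decide_eq_true_eq] at he
      rcases he with he | ⟨-, he⟩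
      · exact he
      · omega
    cases r with
    | advance => simp [delivered, ih he', isCorrupt_of_early he' P] at hd
    | corrupt Q => simp [delivered, ih he'] at hd

theorem delivered_mono {P : Party} (hs : h <:+ h') (hd : delivered T h P = true) :
    delivered T h' P = true := by
  induction h' with
  | nil => rwa [List.suffix_nil.1 hs] at hd
  | cons r h' ih =>
    rcases List.suffix_cons_iff.1 hs with rfl | hs
    · exact hd
    · have := ih hs
      cases r <;> simp [delivered, this]

theorem delivered_eq_false_of_suffix {P : Party} (hs : h <:+ h') (he : early T h' = true) :
    delivered (T + 2) h P = false := by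
  by_contra hd
  rw [Bool.not_eq_false] at hd
  have := delivered_mono hs hd
  rw [delivered_eq_false_of_early he] at this
  cases this

theorem isCorrupt_of_firstB (hf : firstB h = true) : isCorrupt h .B = true := by
  induction h with
  | nil => simp [firstB] at hf
  | cons r h ih =>
    simp only [firstB, Bool.or_eq_true, Bool.and_eq_true, decide_eq_true_eq] at hf
    rcases hf with hf | ⟨rfl, -⟩
    · exact isCorrupt_cons r (ih hf)
    · simp

theorem firstB_of_isCorrupt (hB : isCorrupt h .B = true) (hA : isCorrupt h .A = false) :
    firstB h = true := by
  induction h with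
  | nil => simp at hB
  | cons r h ih =>
    rcases r with _ | _ | _
    · simp_all [firstB]
    · simp at hA
    · simp_all [firstB]

/-- Which party is corrupted first does not change after the first corruption. -/
theorem firstB_of_suffix {P : Party} (hs : h <:+ h') (hP : isCorrupt h P = true) :
    firstB h' = firstB h := by
  induction h' with
  | nil => rw [List.suffix_nil.1 hs]
  | cons r h' ih =>
    rcases List.suffix_cons_iff.1 hs with rfl | hs
    · rfl
    · rw [← ih hs]
      have hc : firstB h' = true ∨ isCorrupt h' .A = true := by
        rw [ih hs]
        by_cases hA : isCorrupt h .A = true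
        · right
          exact isCorrupt_mono hs hA
        · cases P with
          | A => exact absurd hP hA
          | B => exact .inl (firstB_of_isCorrupt hP (Bool.not_eq_true _ ▸ hA))
      rw [firstB]
      rcases hc with hc | hc <;> simp [hc]

end History

/-! ### Keeping track of an execution -/

open History

/-- The event of the corruption of `P`, or `nil` if `P` is honest. -/
def corruption (x z : Party → Data) (h : History) (P : Party) : Data :=
  if h.isCorrupt P = true then simEvent x z (.corrupt P) else nil

theorem toBool_corruption (x z : Party → Data) (h : History) (P : Party) :
    (corruption x z h P).toBool = h.isCorrupt P := by
  unfold corruption; cases isCorrupt h P <;> rfl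

/-- What matters about the history `h` of an execution whose protocol run has `T` rounds: the number
of advances, for each party the event of its corruption, whether `B` was corrupted first, whether
both parties were corrupt early, and whose outputs were delivered. -/
def status (T : ℕ) (x z : Party → Data) (h : History) : Data :=
  cons (unary h.advances) (cons (cons (corruption x z h .A) (corruption x z h .B))
    (cons (bit h.firstB) (cons (bit (h.early T))
      (cons (bit (delivered (T + 2) h .A)) (bit (delivered (T + 2) h .B))))))

namespace Status

/-- The number of advances, in unary. -/
def time (st : Data) : Data := st.fst
/-- The corruption event of `A`. -/
def corruptA (st : Data) : Data := st.snd.fst.fst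
/-- The corruption event of `B`. -/
def corruptB (st : Data) : Data := st.snd.fst.snd
/-- The flag that `B` was corrupted before `A`. -/
def firstB (st : Data) : Data := st.snd.snd.fst
/-- The flag for early corruption of both parties. -/
def early (st : Data) : Data := st.snd.snd.snd.fst
/-- The flag for delivery of the output of `A`. -/
def deliveredA (st : Data) : Data := st.snd.snd.snd.snd.fst
/-- The flag for delivery of the output of `B`. -/
def deliveredB (st : Data) : Data := st.snd.snd.snd.snd.snd

/-- The new value of the flag for early corruption of both parties, when `a` and `b` are the new
corruption events of `A` and `B`. -/
def newEarly (T : ℕ) (st a b : Data) : Data :=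
  if (early st).toBool = true then early st
  else if a.toBool = true then
    if b.toBool = true then if (time st).len < T + 1 then bit true else nil else nil
  else nil

/-- The new value of the flag `d` for delivery of its output by a party with corruption
event `c`, when the execution proceeds. -/
def newDelivered (T : ℕ) (st c d : Data) : Data :=
  if d.toBool = true then d
  else if c.toBool = true then nil
  else if (time st).len < T + 2 then nil
  else if (time st).len < T + 3 then bit true else nil

/-- The status after the event `ev`. -/
def update (T : ℕ) (st ev : Data) : Data :=
  if ev.toBool = true then
    if ev.fst.toBool = true then
      cons (time st) (cons (cons (corruptA st) ev)
        (cons (if (corruptA st).toBool = true then firstB st else bit true)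
          (cons (newEarly T st (corruptA st) ev) (cons (deliveredA st) (deliveredB st)))))
    else
      cons (time st) (cons (cons ev (corruptB st))
        (cons (firstB st)
          (cons (newEarly T st ev (corruptB st)) (cons (deliveredA st) (deliveredB st)))))
  else
    cons (cons nil (time st)) (cons (cons (corruptA st) (corruptB st))
      (cons (firstB st) (cons (early st)
        (cons (newDelivered T st (corruptA st) (deliveredA st))
          (newDelivered T st (corruptB st) (deliveredB st))))))

variable {T : ℕ} {x z : Party → Data} {h : History}

theorem time_status : time (status T x z h) = unary h.advances := rfl
theorem corruptA_status : corruptA (status T x z h) = corruption x z h .A := rfl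
theorem corruptB_status : corruptB (status T x z h) = corruption x z h .B := rfl
theorem firstB_status : firstB (status T x z h) = bit h.firstB := rfl
theorem early_status : early (status T x z h) = bit (h.early T) := rfl
theorem deliveredA_status : deliveredA (status T x z h) = bit (delivered (T + 2) h .A) := rfl
theorem deliveredB_status : deliveredB (status T x z h) = bit (delivered (T + 2) h .B) := rfl

end Status

theorem newDelivered_status {T : ℕ} {x z : Party → Data} {h : History} {P : Party} {c : Data}
    (hc : c.toBool = isCorrupt h P) :
    Status.newDelivered T (status T x z h) c (bit (delivered (T + 2) h P)) =
      bit (delivered (T + 2) (.advance :: h) P) := by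
  simp only [Status.newDelivered, Status.time, status, fst_cons, len_unary, toBool_bit,
    delivered, hc]
  rcases lt_trichotomy (advances h) (T + 2) with hT | hT | hT
  · cases delivered (T + 2) h P <;> cases isCorrupt h P <;> simp [hT, hT.ne, bit]
  · cases delivered (T + 2) h P <;> cases isCorrupt h P <;> simp [hT, bit]
  · have h1 : ¬ advances h < T + 3 := by omega
    cases delivered (T + 2) h P <;> cases isCorrupt h P <;> simp [h1, hT.ne', bit]

theorem newEarly_status {T : ℕ} {x z : Party → Data} {h : History} {Q : Party} {a b : Data}
    (ha : a.toBool = isCorrupt (.corrupt Q :: h) .A)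
    (hb : b.toBool = isCorrupt (.corrupt Q :: h) .B) :
    Status.newEarly T (status T x z h) a b = bit (early T (.corrupt Q :: h)) := by
  simp only [Status.newEarly, Status.time, Status.early, status, fst_cons, snd_cons, len_unary,
    toBool_bit, History.early, ha, hb, advances_corrupt, Nat.lt_succ_iff]
  cases History.early T h <;> cases isCorrupt (.corrupt Q :: h) .A <;>
    cases isCorrupt (.corrupt Q :: h) .B <;> by_cases hT : advances h ≤ T <;> simp [hT, bit]

theorem early_advance (T : ℕ) (h : History) : early T (.advance :: h) = early T h := by
  rw [History.early, Bool.or_eq_left_iff_imp]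
  simp only [isCorrupt_advance, advances_advance, Bool.and_eq_true, decide_eq_true_eq]
  exact fun ⟨⟨hA, hB⟩, hT⟩ => early_of_isCorrupt hA hB (by omega)

theorem toBool_simEvent (x z : Party → Data) (P : Party) :
    (simEvent x z (.corrupt P)).toBool = true := rfl

theorem corruption_corrupt (x z : Party → Data) (h : History) (P Q : Party) :
    corruption x z (.corrupt Q :: h) P =
      if P = Q then simEvent x z (.corrupt P) else corruption x z h P := by
  unfold corruption; by_cases hPQ : P = Q <;> simp [hPQ]

theorem update_status (T : ℕ) (x z : Party → Data) (h : History) (r : Request) :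
    Status.update T (status T x z h) (simEvent x z r) = status T x z (r :: h) := by
  have hd (P : Party) := newDelivered_status (T := T) (x := x) (z := z) (toBool_corruption x z h P)
  have hA := newEarly_status (T := T) (x := x) (z := z) (h := h) (Q := .A)
    (a := simEvent x z (.corrupt .A)) (by simp [toBool_simEvent])
    ((toBool_corruption x z h .B).trans (by simp))
  have hB := newEarly_status (T := T) (x := x) (z := z) (h := h) (Q := .B)
    (b := simEvent x z (.corrupt .B)) ((toBool_corruption x z h .A).trans (by simp))
    (by simp [toBool_simEvent])
  unfold Status.update
  simp only [Status.time_status, Status.corruptA_status, Status.corruptB_status,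
    Status.firstB_status, Status.early_status, Status.deliveredA_status,
    Status.deliveredB_status, hd]
  rcases r with _ | _ | _
  · simp [simEvent, status, early_advance, History.firstB, unary_succ, corruption]
  · rw [if_pos (toBool_simEvent x z .A), if_neg (by simp [simEvent, list, Party.bit, bit]), hA]
    simp [status, History.firstB, delivered, corruption_corrupt]
  · rw [if_pos (toBool_simEvent x z .B), if_pos (by simp [simEvent, list, Party.bit, bit]), hB]
    simp only [status, History.firstB, delivered, toBool_corruption, advances_corrupt,
      corruption_corrupt]
    cases isCorrupt h .A <;> cases History.firstB h <;> simp [bit]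

theorem Status.size_update_le (T : ℕ) (st ev : Data) :
    (Status.update T st ev).size ≤ st.size + 3 * ev.size + 40 := by
  have hb : (bit true).size = 3 := rfl
  have hn : nil.size = 1 := rfl
  have h1 := size_fst_add_size_snd_le st
  have h2 := size_fst_add_size_snd_le st.snd
  have h3 := size_fst_add_size_snd_le st.snd.fst
  have h4 := size_fst_add_size_snd_le st.snd.snd
  have h5 := size_fst_add_size_snd_le st.snd.snd.snd
  have h6 := size_fst_add_size_snd_le st.snd.snd.snd.snd
  have h7 (a b : Data) : (newEarly T st a b).size ≤ (early st).size + 3 := by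
    unfold newEarly; split_ifs <;> omega
  have h8 (c d : Data) : (newDelivered T st c d).size ≤ d.size + 3 := by
    unfold newDelivered; split_ifs <;> omega
  have h9 := h7 (corruptA st) ev
  have h10 := h7 ev (corruptB st)
  have h11 := h8 (corruptA st) (deliveredA st)
  have h12 := h8 (corruptB st) (deliveredB st)
  have h13 : (if (corruptA st).toBool = true then firstB st else bit true).size ≤
      (firstB st).size + 3 := by split_ifs <;> omega
  simp only [corruptA, corruptB, firstB, early, deliveredA, deliveredB] at *
  unfold update
  simp only [time, corruptA, corruptB, firstB, early, deliveredA, deliveredB]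
  split <;> [split; skip] <;> simp only [Data.size] <;> omega

theorem size_status_le (T : ℕ) (h : History) :
    (status T (fun _ => nil) (fun _ => nil) h).size ≤ 2 * h.length + 60 := by
  have h1 (b : Bool) : (bit b).size ≤ 3 := by cases b <;> simp [bit, Data.size]
  have h2 (P : Party) : (corruption (fun _ => nil) (fun _ => nil) h P).size ≤ 9 := by
    unfold corruption
    split_ifs
    · cases P <;> simp [simEvent, list, bit, Party.bit, Data.size]
    · simp [Data.size]
  have h3 : h.advances ≤ h.length := List.count_le_length
  have := h2 .A
  have := h2 .B
  have := h1 h.firstB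
  have := h1 (h.early T)
  have := h1 (delivered (T + 2) h .A)
  have := h1 (delivered (T + 2) h .B)
  simp only [status, Data.size, size_unary]
  omega

end Histories

/-! ### Executions of the protocol as polynomial-time functions -/
section Executions

open History
variable {R : RingFamily}

namespace Data

/-- The reversal of the list `d`, followed by the list `e`. -/
def revAppend : Data → Data → Data
  | nil, e => e
  | cons a d, e => revAppend d (cons a e)

/-- Moving an item from the first list to the second. -/
def revStep (s : Data) : Data :=
  if s.fst.toBool = true then cons s.fst.snd (cons s.fst.fst s.snd) else s

theorem iterate_revStep (d e : Data) : revStep^[d.len] (cons d e) = cons nil (revAppend d e) := by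
  induction d generalizing e with
  | nil => rfl
  | cons a d _ ih => simp [len, Function.iterate_succ_apply, revStep, revAppend, ih]

theorem size_revStep_le (s : Data) : (revStep s).size ≤ s.size := by
  unfold revStep
  split_ifs with h
  · rcases s with _ | ⟨_ | ⟨a, b⟩, c⟩ <;> simp only [fst_nil, fst_cons, snd_cons, size,
      toBool_nil, Bool.false_eq_true] at h ⊢
    omega
  · rfl

theorem size_iterate_le {f : Data → Data} {c : ℕ} (hf : ∀ s, (f s).size ≤ s.size + c) (i : ℕ)
    (s : Data) : (f^[i] s).size ≤ s.size + c * i := by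
  induction i with
  | zero => simp
  | succ i ih =>
    rw [Function.iterate_succ_apply', Nat.mul_succ]
    have := hf (f^[i] s)
    omega

theorem revAppend_list (l : List Data) (e : Data) :
    revAppend (list l) e = l.foldl (fun s a => cons a s) e := by
  induction l generalizing e with
  | nil => rfl
  | cons a l ih => rw [list, revAppend, ih]; rfl

theorem revAppend_list_nil (l : List Data) : revAppend (list l) nil = list l.reverse := by
  rw [revAppend_list, ← List.foldr_reverse]
  induction l.reverse with
  | nil => rfl
  | cons a l ih => rw [List.foldr_cons, ih]; rfl

theorem exists_eq_list (d : Data) : ∃ l, d = list l := by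
  induction d with
  | nil => exact ⟨[], rfl⟩
  | cons a d _ ih => exact ih.elim fun l hl => ⟨a :: l, hl ▸ rfl⟩

theorem revAppend_revAppend_nil (d : Data) : revAppend (revAppend d nil) nil = d := by
  obtain ⟨l, rfl⟩ := exists_eq_list d
  rw [revAppend_list_nil, revAppend_list_nil, List.reverse_reverse]

@[simp] theorem len_list (l : List Data) : (list l).len = l.length := by
  induction l with
  | nil => rfl
  | cons a l ih => rw [list, len, ih]; rfl

/-- Answering the next OT; the state consists of the choice bits, the pairs of strings and the
answers so far, the latest one first. -/
def otStep (s : Data) : Data :=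
  if s.fst.toBool = true then
    if s.snd.fst.toBool = true then
      cons s.fst.snd (cons s.snd.fst.snd (cons
        (if s.fst.fst.toBool = true then s.snd.fst.fst.snd else s.snd.fst.fst.fst) s.snd.snd))
    else s
  else s

theorem iterate_otStep (c w a : Data) :
    (otStep^[c.len] (cons c (cons w a))).snd.snd = revAppend (otAnswers c w) a := by
  induction c generalizing w a with
  | nil => rfl
  | cons b c _ ih =>
    cases w with
    | nil =>
      have h (n : ℕ) : otStep^[n] (cons (cons b c) (cons nil a)) = cons (cons b c) (cons nil a) :=
        Function.iterate_fixed rfl n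
      rw [h]; rfl
    | cons v w =>
      simp [len, Function.iterate_succ_apply, otStep, ih, otAnswers, revAppend]
      rfl

theorem size_otStep_le (s : Data) : (otStep s).size ≤ s.size := by
  unfold otStep
  split_ifs with h1 h2 h3
  all_goals try rfl
  all_goals
    rcases s with _ | ⟨_ | ⟨a, b⟩, _ | ⟨_ | ⟨v, w⟩, c⟩⟩ <;> simp at h1 h2
    have := size_fst_le v
    have := size_snd_le v
    simp only [fst_cons, snd_cons, size]
    omega

theorem size_otAnswers_le (c w : Data) : (otAnswers c w).size ≤ w.size := by
  induction c generalizing w with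
  | nil => cases w <;> simp [otAnswers, size]; omega
  | cons b c _ ih =>
    cases w with
    | nil => simp [otAnswers, size]
    | cons v w =>
      have := size_fst_le v
      have := size_snd_le v
      have := ih w
      simp only [otAnswers, size]
      split_ifs <;> omega

end Data

theorem size_deliver_le (a b : Data) : (deliver a b).size ≤ 1 + 2 * b.size := by
  have := size_otAnswers_le a.snd.snd b.snd.fst
  have := size_fst_le b.snd
  have := size_fst_add_size_snd_le b
  have := size_pos b
  have := size_fst_le b
  have := size_snd_le b
  simp only [deliver, Data.size]
  omega

namespace PolyTime

variable {f g h : ℕ → List Bool → Data → Data}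

theorem loop_of_size_le {c : ℕ} (hf : PolyTime R f) (hg : PolyTime R g) (hh : PolyTime R h)
    (hb : ∀ k id s, (f k id s).size ≤ s.size + c) :
    PolyTime R fun k id x => (f k id)^[(g k id x).len] (h k id x) := by
  obtain ⟨q, hq⟩ := hh.size
  refine hf.loop hg hh ⟨q + .C c * .X, fun k id x i => (size_iterate_le (hb k id) i _).trans ?_⟩
  have h1 := (hq k id x).trans (eval_le_eval q (Nat.le_add_right _ i))
  have h2 : c * i ≤ c * ((inp k id x).size + i) := Nat.mul_le_mul_left _ (Nat.le_add_left _ _)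
  simp only [Polynomial.eval_add, Polynomial.eval_mul, Polynomial.eval_C, Polynomial.eval_X] at h1 ⊢
  omega

theorem reverse (hf : PolyTime R f) : PolyTime R fun k id x => revAppend (f k id x) Data.nil := by
  have hstep : PolyTime R fun _ _ => revStep :=
    (fst arg).ite ((snd (fst arg)).cons ((fst (fst arg)).cons (snd arg))) arg
  refine (congrArg (PolyTime R) ?_).mp
    (hstep.loop_of_size_le (c := 0) hf (hf.cons nil) fun _ _ => size_revStep_le).snd
  funext k id x
  rw [iterate_revStep, Data.snd]

theorem otAnswers (hf : PolyTime R f) (hg : PolyTime R g) :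
    PolyTime R fun k id x => otAnswers (f k id x) (g k id x) := by
  have hstep : PolyTime R fun _ _ => otStep := by
    unfold otStep
    repeat first
      | exact arg
      | apply PolyTime.ite
      | apply PolyTime.cons
      | apply PolyTime.fst
      | apply PolyTime.snd
  refine (congrArg (PolyTime R) ?_).mp
    (hstep.loop_of_size_le (c := 0) hf (hf.cons (hg.cons nil)) fun _ _ => size_otStep_le).snd.snd.reverse
  funext k id x
  rw [iterate_otStep, revAppend_revAppend_nil]

theorem deliver (hf : PolyTime R f) (hg : PolyTime R g) :
    PolyTime R fun k id x => deliver (f k id x) (g k id x) :=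
  hg.fst.cons (hf.snd.snd.otAnswers hg.snd.fst)

end PolyTime

open PolyTime

namespace Protocol

variable {π : Protocol}

/-- One round, as a function on pairs of views. -/
def step (π : Protocol) (k : ℕ) (id : List Bool) (v : Data) : Data :=
  cons (cons v.fst.fst (cons v.fst.snd.fst
      (cons (deliver (π.next .A k id v.fst) (π.next .B k id v.snd)) v.fst.snd.snd)))
    (cons v.snd.fst (cons v.snd.snd.fst
      (cons (deliver (π.next .B k id v.snd) (π.next .A k id v.fst)) v.snd.snd.snd)))

/-- The views of both parties in a complete execution, on inputs and tapes
`((x A, ω A), (x B, ω B))`. -/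
def views (π : Protocol) (k : ℕ) (id : List Bool) (y : Data) : Data :=
  (π.step k id)^[π.rounds k id]
    (cons (cons y.fst.fst (cons y.fst.snd nil)) (cons y.snd.fst (cons y.snd.snd nil)))

theorem iterate_step (k : ℕ) (id : List Bool) (x ω : Party → Data) (t : ℕ) :
    (π.step k id)^[t]
      (cons (cons (x .A) (cons (ω .A) nil)) (cons (x .B) (cons (ω .B) nil))) =
    cons (cons (x .A) (cons (ω .A) (π.received k id x ω t .A)))
      (cons (x .B) (cons (ω .B) (π.received k id x ω t .B))) := by
  induction t with
  | zero => rfl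
  | succ t ih => rw [Function.iterate_succ_apply', ih]; rfl

theorem views_eq (k : ℕ) (id : List Bool) (x ω : Party → Data) :
    π.views k id (cons (cons (x .A) (ω .A)) (cons (x .B) (ω .B))) =
      cons (π.view k id x ω .A) (π.view k id x ω .B) :=
  iterate_step k id x ω _

theorem size_received_le {b : ℕ} {k : ℕ} {id : List Bool}
    (hb : ∀ P v, (π.next P k id v).size ≤ b) (x ω : Party → Data) (t : ℕ) (P : Party) :
    (π.received k id x ω t P).size ≤ 1 + t * (2 + 2 * b) := by
  induction t generalizing P with
  | zero => simp [received, Data.size]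
  | succ t ih =>
    have h1 := size_deliver_le
      (π.next P k id (cons (x P) (cons (ω P) (received π k id x ω t P))))
      (π.next P.other k id (cons (x P.other) (cons (ω P.other) (received π k id x ω t P.other))))
    have h2 := hb P.other (cons (x P.other) (cons (ω P.other) (received π k id x ω t P.other)))
    have h3 := ih P
    have h4 : (t + 1) * (2 + 2 * b) = t * (2 + 2 * b) + (2 + 2 * b) := by ring
    simp only [received, Data.size]
    omega

theorem polyTime_views (hπ : π.Efficient R) : PolyTime R π.views := by
  obtain ⟨hr, -, -, hn, -, q, hq⟩ := hπ
  have hstep : PolyTime R π.step := by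
    unfold step
    repeat first
      | exact arg
      | apply PolyTime.deliver
      | apply PolyTime.cons
      | apply (hn .A).comp
      | apply (hn .B).comp
      | apply PolyTime.fst
      | apply PolyTime.snd
  have hinit : PolyTime R fun _ _ y =>
      cons (cons y.fst.fst (cons y.fst.snd nil)) (cons y.snd.fst (cons y.snd.snd nil)) :=
    ((fst (fst arg)).cons ((snd (fst arg)).cons nil)).cons
      ((fst (snd arg)).cons ((snd (snd arg)).cons nil))
  refine (congrArg (PolyTime R) ?_).mp (hstep.loop hr hinit
    ⟨7 + 4 * .X + 2 * (.X * (2 + 2 * q)), fun k id y i => ?_⟩)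
  · funext k id y
    rw [len_unary]; rfl
  · let x : Party → Data := fun P => match P with | .A => y.fst.fst | .B => y.snd.fst
    let ω : Party → Data := fun P => match P with | .A => y.fst.snd | .B => y.snd.snd
    have h := iterate_step (π := π) k id x ω i
    simp only [x, ω] at h
    rw [h]
    have h1 := size_received_le (fun P v => (hq P k id v).1) x ω i
    have h2 := h1 .A
    have h3 := h1 .B
    have h4 := size_inp k id y
    have h5 := two_mul_length_lt_size_bits id
    have h6 : q.eval (k + id.length) ≤ q.eval ((inp k id y).size + i) :=
      eval_le_eval q (by omega)
    have h7 : i * (2 + 2 * q.eval (k + id.length)) ≤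
        ((inp k id y).size + i) * (2 + 2 * q.eval ((inp k id y).size + i)) := by gcongr; omega
    have h8 := size_fst_add_size_snd_le y
    have h9 := size_fst_add_size_snd_le y.fst
    have h10 := size_fst_add_size_snd_le y.snd
    simp only [x, ω] at h2 h3
    simp only [Data.size, Polynomial.eval_add, Polynomial.eval_mul, Polynomial.eval_X,
      Polynomial.eval_ofNat] at h7 ⊢
    omega

theorem len_received (k : ℕ) (id : List Bool) (x ω : Party → Data) (t : ℕ) (P : Party) :
    (π.received k id x ω t P).len = t := by
  induction t with
  | zero => rfl
  | succ t ih => rw [received, len, ih]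

/-- What was received in the first rounds is a final segment of what was received. -/
theorem iterate_snd_received (k : ℕ) (id : List Bool) (x ω : Party → Data) (t i : ℕ) (P : Party) :
    Data.snd^[i] (π.received k id x ω (t + i) P) = π.received k id x ω t P := by
  induction i with
  | zero => rfl
  | succ i ih => rw [Function.iterate_succ_apply, ← Nat.add_assoc, received, snd_cons, ih]

end Protocol

namespace Status

/-- The status after the events in the list `l`, the latest event first. -/
def ofEvents (T : ℕ) (l : Data) : Data :=
  ((fun s => cons s.fst.snd (update T s.snd s.fst.fst))^[l.len]
    (cons (revAppend l nil) (status T (fun _ => nil) (fun _ => nil) []))).snd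

theorem iterate_update (T : ℕ) (l : List Data) (st : Data) :
    (fun s => cons s.fst.snd (update T s.snd s.fst.fst))^[l.length] (cons (list l) st) =
      cons nil (l.foldl (update T) st) := by
  induction l generalizing st with
  | nil => rfl
  | cons a l ih =>
    rw [List.length_cons, Function.iterate_succ_apply]
    exact ih _

theorem ofEvents_map (T : ℕ) (x z : Party → Data) (h : History) :
    ofEvents T (list (h.map (simEvent x z))) = status T x z h := by
  have h1 := iterate_update T (h.map (simEvent x z)).reverse
    (status T (fun _ => nil) (fun _ => nil) [])
  rw [List.length_reverse] at h1
  rw [ofEvents, len_list, revAppend_list_nil, h1, snd_cons, List.foldl_reverse]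
  clear h1
  induction h with
  | nil => rfl
  | cons r h ih => rw [List.map_cons, List.foldr_cons, ih, update_status]

variable {n : ℕ → List Bool → ℕ} {f g : ℕ → List Bool → Data → Data}

theorem polyTime_update (hn : PolyLength R n) (hf : PolyTime R f) (hg : PolyTime R g) :
    PolyTime R fun k id x => update (n k id) (f k id x) (g k id x) := by
  have h : PolyTime R fun k id y => update (n k id) y.fst y.snd := by
    unfold update newEarly newDelivered time corruptA corruptB firstB early deliveredA deliveredB
    repeat first
      | exact arg
      | exact const _
      | exact hn.succ
      | exact hn.succ.succ
      | exact hn.succ.succ.succ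
      | apply PolyTime.ite
      | apply PolyTime.ite_len_lt
      | apply PolyTime.cons
      | apply PolyTime.fst
      | apply PolyTime.snd
  exact h.comp (hf.cons hg)

theorem polyTime_ofEvents (hn : PolyLength R n) (hf : PolyTime R f) :
    PolyTime R fun k id x => ofEvents (n k id) (f k id x) := by
  obtain ⟨q, hq⟩ := hf.reverse.size
  -- the potential that stays linear: every item of the list is paid for when it is consumed
  have hpot (T : ℕ) (i : ℕ) (s : Data) :
      let s' := (fun s => Data.cons s.fst.snd (update T s.snd s.fst.fst))^[i] s
      s'.snd.size + 3 * s'.fst.size ≤ s.snd.size + 3 * s.fst.size + 43 * i := by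
    induction i with
    | zero => simp
    | succ i ih =>
      rw [Function.iterate_succ_apply']
      set s' := (fun s => Data.cons s.fst.snd (update T s.snd s.fst.fst))^[i] s
      have h1 := size_update_le T s'.snd s'.fst.fst
      have h2 := size_fst_add_size_snd_le s'.fst
      simp only [fst_cons, snd_cons] at ih ⊢
      omega
  have hmain := ((PolyTime.cons (fst arg).snd (polyTime_update hn (snd arg) (fst arg).fst)).loop hf
    (hf.reverse.cons (const (status 0 (fun _ => Data.nil) (fun _ => Data.nil) [])))
    ⟨3 * q + 43 * .X + 100, fun k id x i => ?_⟩).snd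
  · exact hmain
  · have h1 := hpot (n k id) i (Data.cons (revAppend (f k id x) Data.nil)
      (status 0 (fun _ => Data.nil) (fun _ => Data.nil) []))
    have h2 := (hq k id x).trans (eval_le_eval q (Nat.le_add_right _ i))
    have h3 := size_status_le 0 []
    cases i with
    | zero =>
      simp only [Function.iterate_zero, _root_.id, Data.size, Polynomial.eval_add,
        Polynomial.eval_mul, Polynomial.eval_X, Polynomial.eval_ofNat, List.length_nil] at h2 h3 ⊢
      omega
    | succ i =>
      simp only [Function.iterate_succ_apply', fst_cons, snd_cons, Data.size, Polynomial.eval_add,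
        Polynomial.eval_mul, Polynomial.eval_X, Polynomial.eval_ofNat, List.length_nil]
        at h1 h2 h3 ⊢
      omega

end Status

end Executions

/-! ### Profiles: what determines the states of a party -/
section Profiles

open History PolyTime
variable {R : RingFamily} {π : Protocol}

/-- The component of the pair `d` that belongs to a party. -/
def Party.proj : Party → Data → Data
  | .A, d => d.fst
  | .B, d => d.snd

/-- The pair with component `a` for `P` and component `b` for the other party. -/
def Party.pair : Party → Data → Data → Data
  | .A, a, b => cons a b
  | .B, a, b => cons b a

@[simp] theorem Party.proj_pair (P : Party) (a b : Data) : P.proj (P.pair a b) = a := by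
  cases P <;> rfl

@[simp] theorem Party.proj_other_pair (P : Party) (a b : Data) :
    P.other.proj (P.pair a b) = b := by
  cases P <;> rfl

@[simp] theorem Party.other_ne (P : Party) : P.other ≠ P := by cases P <;> simp [Party.other]

theorem Party.eq_or_eq_other (P Q : Party) : Q = P ∨ Q = P.other := by
  cases P <;> cases Q <;> simp [Party.other]

/-- All that determines the states of a party in an execution of the derandomized protocol: its
input `x`, its random input `r` and its output `s` in the run of `π`, the correction `m` that it
receives, and its view `v` of the run. -/
def profile (x r s m v : Data) : Data := cons x (cons r (cons s (cons m v)))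

/-- The state after `t` rounds of a party with profile `p`, where the run of `π` has `T` rounds. -/
def profileState (T : ℕ) (p t : Data) : Data :=
  if t.len < T + 1 then
    cons (unary 0) (cons p.fst (cons p.snd.snd.snd.snd.fst (cons p.snd.snd.snd.snd.snd.fst
      (Data.snd^[(Data.snd^[t.len] (unary T)).len] p.snd.snd.snd.snd.snd.snd))))
  else if t.len < T + 2 then cons (unary 1) (cons p.fst (cons p.snd.fst p.snd.snd.fst))
  else cons (unary 2) (cons p.fst (cons p.snd.fst (cons p.snd.snd.fst p.snd.snd.snd.fst)))

/-- The output of a party with profile `p`. -/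
def profileOut (R : RingFamily) (P : Party) (id : List Bool) (p : Data) : Data :=
  Derandomized.out R P id
    (cons (unary 2) (cons p.fst (cons p.snd.fst (cons p.snd.snd.fst p.snd.snd.snd.fst))))

/-- The states of the corrupt parties, for a pair of profiles and a status. -/
def corruptStates (T : ℕ) (p st : Data) : Data :=
  cons
    (if (Status.corruptA st).toBool = true then cons nil (profileState T p.fst (Status.time st))
      else nil)
    (if (Status.corruptB st).toBool = true then cons nil (profileState T p.snd (Status.time st))
      else nil)

/-- What is observed, for a pair of profiles and a status. -/
def observation (R : RingFamily) (T : ℕ) (id : List Bool) (p st : Data) : Data :=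
  cons (corruptStates T p st) (cons
    (if (Status.deliveredA st).toBool = true then cons nil (profileOut R .A id p.fst) else nil)
    (if (Status.deliveredB st).toBool = true then cons nil (profileOut R .B id p.snd) else nil))

/-- The profiles in the execution that is determined by `y = ((xA, xB), ((rA, ωA), (rB, ωB)))`. -/
def execProfiles (R : RingFamily) (π : Protocol) (k : ℕ) (id : List Bool) (y : Data) : Data :=
  cons
    (profile y.fst.fst (π.views k id y.snd).fst.fst (π.out .A k id (π.views k id y.snd).fst)
      (R.query .sub id y.fst.snd (π.views k id y.snd).snd.fst) (π.views k id y.snd).fst)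
    (profile y.fst.snd (π.views k id y.snd).snd.fst (π.out .B k id (π.views k id y.snd).snd)
      (R.query .sub id y.fst.fst (π.views k id y.snd).fst.fst) (π.views k id y.snd).snd)

theorem len_iterate_snd (n : ℕ) (d : Data) : (Data.snd^[n] d).len = d.len - n := by
  induction n generalizing d with
  | zero => rfl
  | succ n ih => cases d <;> simp [Function.iterate_succ_apply, ih, len]

theorem profileState_run {T t : ℕ} (ht : t ≤ T) (x r s m v : Data) :
    profileState T (profile x r s m v) (unary t) =
      cons (unary 0) (cons x (cons v.fst (cons v.snd.fst (Data.snd^[T - t] v.snd.snd)))) := by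
  simp [profileState, profile, Nat.lt_succ_of_le ht, len_iterate_snd]

theorem profileState_erased {T t : ℕ} (ht : T < t) (x r s m v v' : Data) :
    profileState T (profile x r s m v) (unary t) =
      profileState T (profile x r s m v') (unary t) := by
  simp [profileState, profile, Nat.not_lt.2 (Nat.succ_le_of_lt ht)]

/-- The states of the parties in an execution of the derandomized protocol. -/
theorem state_derandomized (k : ℕ) (id : List Bool) (x r c ω : Party → Data) (t : ℕ) (P : Party) :
    (derandomized R π).state k id x (fun P => cons (c P) (cons (r P) (ω P)))
      (min t (π.rounds k id + 2)) P =
    profileState (π.rounds k id)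
      (profile (x P) (r P) (π.output k id r (fun P => cons (c P) (ω P)) P)
        (R.query .sub id (x P.other) (r P.other))
        (π.view k id r (fun P => cons (c P) (ω P)) P)) (unary t) := by
  set ω' : Party → Data := fun P => cons (c P) (ω P)
  set T := π.rounds k id
  have hrun (t : ℕ) (ht : t ≤ T) (P : Party) :
      (derandomized R π).state k id x (fun P => cons (c P) (cons (r P) (ω P))) t P =
        cons (unary 0) (cons (x P) (cons (r P) (cons (ω' P) (π.received k id r ω' t P)))) := by
    induction t generalizing P with
    | zero => rfl
    | succ t ih =>
      have hlt : t < π.rounds k id := ht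
      rw [ErasingProtocol.state]
      simp only [ih (Nat.le_of_succ_le ht)]
      simp only [derandomized, Derandomized.recv, Derandomized.send, unary, List.replicate, list,
        Protocol.len_received, hlt, if_true, Protocol.received]
  have herased (P : Party) :
      (derandomized R π).state k id x (fun P => cons (c P) (cons (r P) (ω P))) (T + 1) P =
        cons (unary 1) (cons (x P) (cons (r P) (π.output k id r ω' P))) := by
    rw [ErasingProtocol.state]
    simp only [hrun T le_rfl]
    simp only [derandomized, Derandomized.recv, unary, List.replicate, list,
      Protocol.len_received, T, lt_irrefl, if_false]
    rfl
  rcases Nat.lt_trichotomy t (T + 1) with ht | rfl | ht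
  · rw [min_eq_left (by omega), hrun t (by omega), profileState_run (by omega)]
    have := Protocol.iterate_snd_received (π := π) k id r ω' t (T - t) P
    rw [show t + (T - t) = T by omega] at this
    simp [Protocol.view, T, this]
  · rw [min_eq_left (by omega), herased]
    simp [profileState, profile]
  · rw [min_eq_right (by omega), ErasingProtocol.state]
    simp only [herased]
    have h1 : ¬ t < T + 1 := by omega
    have h2 : ¬ t < T + 2 := by omega
    simp only [profileState, profile, len_unary, h1, h2, if_false, fst_cons, snd_cons]
    rfl

theorem observation_status (T : ℕ) (id : List Bool) (p : Data) (x z : Party → Data)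
    (h : History) :
    observation R T id p (status T x z h) =
      cons (corruptStates T p (status T x z h))
        (h.outputs (T + 2) fun P => profileOut R P id (P.proj p)) := by
  simp only [observation, Status.deliveredA_status, Status.deliveredB_status, toBool_bit]
  rfl

theorem corruptStates_status (T : ℕ) (p : Data) (x z : Party → Data) (h : History) :
    corruptStates T p (status T x z h) =
      cons
        (if h.isCorrupt .A = true then cons nil (profileState T p.fst (unary h.advances)) else nil)
        (if h.isCorrupt .B = true then cons nil (profileState T p.snd (unary h.advances))
          else nil) := by
  simp only [corruptStates, Status.corruptA_status, Status.corruptB_status, toBool_corruption,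
    Status.time_status]

theorem corruptStates_congr {T : ℕ} {p p' : Data} {h : History} (x z : Party → Data)
    (x' z' : Party → Data)
    (hp : ∀ P, h.isCorrupt P = true → profileState T (P.proj p) (unary h.advances) =
      profileState T (P.proj p') (unary h.advances)) :
    corruptStates T p (status T x z h) = corruptStates T p' (status T x' z' h) := by
  rw [corruptStates_status, corruptStates_status]
  congr 1 <;> split_ifs with hc
  · exact congrArg _ (hp .A hc)
  · rfl
  · exact congrArg _ (hp .B hc)
  · rfl

theorem execProfiles_eq (k : ℕ) (id : List Bool) (x r ω : Party → Data) (P : Party) :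
    P.proj (execProfiles R π k id (cons (cons (x .A) (x .B))
      (cons (cons (r .A) (ω .A)) (cons (r .B) (ω .B))))) =
    profile (x P) (r P) (π.output k id r ω P) (R.query .sub id (x P.other) (r P.other))
      (π.view k id r ω P) := by
  simp only [execProfiles, fst_cons, snd_cons, Protocol.views_eq]
  cases P <;> rfl

/-- In the real execution the profiles are those determined by the random inputs and tapes. -/
theorem realWorld_derandomized (k : ℕ) (id : List Bool) (x r c ω x' z' : Party → Data)
    (h : History) :
    realWorld (derandomized R π) k id x (fun P => cons (c P) (cons (r P) (ω P))) h =
      observation R (π.rounds k id) id (execProfiles R π k id (cons (cons (x .A) (x .B))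
        (cons (cons (r .A) (cons (c .A) (ω .A))) (cons (r .B) (cons (c .B) (ω .B))))))
        (status (π.rounds k id) x' z' h) := by
  set T := π.rounds k id
  have hp := execProfiles_eq (R := R) (π := π) k id x r (fun P => cons (c P) (ω P))
  rw [observation_status, corruptStates_status]
  have hs := state_derandomized (R := R) (π := π) k id x r c ω
  rw [realWorld]
  congr 1
  · simp only [show (derandomized R π).rounds k id = T + 2 from rfl, T, hs]
    rw [← hp .A, ← hp .B]
    rfl
  · have hout (P : Party) := hs (π.rounds k id + 2) P
    simp only [min_self] at hout
    simp only [show (derandomized R π).rounds k id = T + 2 from rfl]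
    congr 1
    funext P
    simp only [T, hout, hp]
    simp [profileState, profileOut, profile, derandomized]

/-! ### The simulator for adaptive corruption -/

/-- The product that a party `P` with input `x` and random input `r` adds to its share in the run of
`π`, when it has received the correction `m`. -/
def correction (R : RingFamily) (P : Party) (id : List Bool) (x r m : Data) : Data :=
  match P with
  | .A => R.query .mul id x m
  | .B => R.query .mul id m r

/-- The profiles that are simulated for the status `y.snd` with random tape `y.fst`, when `P` is the
first corrupt party. The random input `r` of `P` and the correction `m` that `P` receives are
uniform; with the output `z` of `P` they determine its share `s` in the run of `π`, and a run with
this share is chosen by the special simulator. If both parties are corrupt early, they are shown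
this run, and otherwise the profile of the other party is determined by its input and output. -/
def simProfiles (R : RingFamily) (S : SpecialSim) (π : Protocol) (P : Party) (k : ℕ)
    (id : List Bool) (y : Data) : Data :=
  let r := y.fst.snd.fst
  let m := y.fst.snd.snd.fst
  let ev := P.proj (cons (Status.corruptA y.snd) (Status.corruptB y.snd))
  let ev' := P.other.proj (cons (Status.corruptA y.snd) (Status.corruptB y.snd))
  let x := ev.snd.fst
  let x' := ev'.snd.fst
  let s := R.query .sub id ev.snd.snd.fst (correction R P id x r m)
  let c := S.choose P k id (list [r, s, cons y.fst.fst y.fst.snd.snd.snd])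
  let e := execProfiles R π k id (cons (P.pair x x') (cons (cons (P.pair r c.fst).fst c.snd.fst)
    (cons (P.pair r c.fst).snd c.snd.snd)))
  let r' := R.query .sub id x' m
  let m' := R.query .sub id x r
  if (Status.early y.snd).toBool = true then e
  else P.pair (profile x r s m (P.proj e).snd.snd.snd.snd)
    (profile x' r' (R.query .sub id ev'.snd.snd.fst (correction R P.other id x' r' m')) m' nil)

/-- The simulator for adaptive corruption. -/
def adaptiveSim (R : RingFamily) (S : SpecialSim) (π : Protocol) : Simulator where
  coins := S.coins
  samples k id := S.samples k id + 2
  report k id y :=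
    let st := Status.ofEvents (π.rounds k id) y.snd
    corruptStates (π.rounds k id)
      (if (Status.firstB st).toBool = true then simProfiles R S π .B k id (cons y.fst st)
        else simProfiles R S π .A k id (cons y.fst st)) st

namespace PolyTime

variable {f g h f₁ f₂ : ℕ → List Bool → Data → Data} {n : ℕ → List Bool → ℕ}

theorem proj (P : Party) (hf : PolyTime R f) : PolyTime R fun k id x => P.proj (f k id x) := by
  cases P
  · exact hf.fst
  · exact hf.snd

theorem pair (P : Party) (hf : PolyTime R f) (hg : PolyTime R g) :
    PolyTime R fun k id x => P.pair (f k id x) (g k id x) := by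
  cases P
  · exact hf.cons hg
  · exact hg.cons hf

theorem correction (P : Party) (hf : PolyTime R f) (hg : PolyTime R g) (hh : PolyTime R h) :
    PolyTime R fun k id x => correction R P id (f k id x) (g k id x) (h k id x) := by
  cases P
  · exact query .mul hf hh
  · exact query .mul hh hg

theorem profileState (hn : PolyLength R n) (hf : PolyTime R f) (hg : PolyTime R g) :
    PolyTime R fun k id x => profileState (n k id) (f k id x) (g k id x) := by
  unfold ProdShare.profileState
  repeat first
    | exact hf
    | exact hg
    | exact const _
    | exact hn
    | exact hn.succ
    | exact hn.succ.succ
    | apply PolyTime.ite_len_lt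
    | apply PolyTime.drop
    | apply PolyTime.cons
    | apply PolyTime.fst
    | apply PolyTime.snd

theorem corruptStates (hn : PolyLength R n) (hf : PolyTime R f) (hg : PolyTime R g) :
    PolyTime R fun k id x => corruptStates (n k id) (f k id x) (g k id x) := by
  unfold ProdShare.corruptStates Status.time Status.corruptA Status.corruptB
  repeat first
    | exact hf
    | exact hg
    | exact const _
    | exact hn
    | apply PolyTime.profileState
    | apply PolyTime.ite
    | apply PolyTime.cons
    | apply PolyTime.fst
    | apply PolyTime.snd

theorem observation (hn : PolyLength R n) (hf : PolyTime R f) (hg : PolyTime R g) :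
    PolyTime R fun k id x => observation R (n k id) id (f k id x) (g k id x) := by
  unfold ProdShare.observation profileOut Status.deliveredA Status.deliveredB
  repeat first
    | exact hf
    | exact hg
    | exact const _
    | exact hn
    | apply PolyTime.corruptStates
    | apply PolyTime.ite
    | apply PolyTime.cons
    | apply (Derandomized.polyTime_out _).comp
    | apply PolyTime.fst
    | apply PolyTime.snd

theorem execProfiles (hπ : π.Efficient R) : PolyTime R (execProfiles R π) := by
  unfold ProdShare.execProfiles profile
  repeat first
    | exact arg
    | apply (hπ.2.2.2.2.1 _).comp
    | apply (Protocol.polyTime_views hπ).comp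
    | apply PolyTime.query
    | apply PolyTime.cons
    | apply PolyTime.fst
    | apply PolyTime.snd

theorem simProfiles {S : SpecialSim} (hπ : π.Efficient R) (hS : S.Efficient R) (P : Party) :
    PolyTime R (simProfiles R S π P) := by
  unfold ProdShare.simProfiles profile Status.corruptA Status.corruptB Status.early
  simp only [list]
  repeat first
    | exact arg
    | exact const _
    | apply PolyTime.ite
    | apply PolyTime.proj
    | apply PolyTime.pair
    | apply PolyTime.correction
    | apply (hS.2.2 _).comp
    | apply (PolyTime.execProfiles hπ).comp
    | apply PolyTime.query
    | apply PolyTime.cons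
    | apply PolyTime.fst
    | apply PolyTime.snd

end PolyTime

theorem adaptiveSim_efficient {S : SpecialSim} (hπ : π.Efficient R) (hS : S.Efficient R) :
    (adaptiveSim R S π).Efficient R := by
  refine ⟨hS.1, hS.2.1.succ.succ, ?_⟩
  have hst := Status.polyTime_ofEvents hπ.1 (snd (R := R) arg)
  have hsim (P : Party) := (PolyTime.simProfiles hπ hS P).comp ((fst (R := R) arg).cons hst)
  exact (((show PolyTime R fun k id y =>
    Status.firstB (Status.ofEvents (π.rounds k id) y.snd) from hst.snd.snd.fst).ite
      (hsim .B) (hsim .A)).corruptStates hπ.1 hst)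

end Profiles

/-! ### Comparing worlds on a class of histories -/
section Worlds

open History
variable {R : RingFamily} {π : Protocol}

namespace History

/-- Whether `P` is the party that was corrupted first (or `A` if there was no corruption), and `e`
says whether both parties were corrupt during the first `T` rounds. -/
def inClass (T : ℕ) (P : Party) (e : Bool) (h : History) : Bool :=
  decide (firstB h = P.bit) && decide (early T h = e)

theorem inClass_iff {T : ℕ} {P : Party} {e : Bool} {h : History} :
    inClass T P e h = true ↔ firstB h = P.bit ∧ early T h = e := by
  simp [inClass]

theorem isCorrupt_first {P Q : Party} {h : History} (hP : firstB h = P.bit)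
    (hQ : isCorrupt h Q = true) : isCorrupt h P = true := by
  cases P with
  | B => exact isCorrupt_of_firstB hP
  | A =>
    by_contra hA
    cases Q with
    | A => exact hA hQ
    | B => rw [firstB_of_isCorrupt hQ (by simpa using hA)] at hP; cases hP

theorem early_of_isCorrupt' {T : ℕ} {P : Party} {h : History} (hP : isCorrupt h P = true)
    (hP' : isCorrupt h P.other = true) (hT : advances h ≤ T) : early T h = true := by
  cases P
  · exact early_of_isCorrupt hP hP' hT
  · exact early_of_isCorrupt hP' hP hT

theorem outputs_eq_of_early {T : ℕ} {h h' : History} (hs : h <:+ h') (he : early T h' = true)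
    (y y' : Party → Data) : h.outputs (T + 2) y = h.outputs (T + 2) y' := by
  simp [outputs, delivered_eq_false_of_suffix hs he]

end History

namespace Environment

variable (E : Environment R) (k : ℕ) (τ : Data) {W W' : History → Data}

theorem interact_congr (n : ℕ) (hW : ∀ h, h <:+ (E.interact k τ W n).1 → W h = W' h) :
    E.interact k τ W n = E.interact k τ W' n := by
  induction n with
  | zero => simp [interact, hW [] (List.suffix_refl _)]
  | succ n ih =>
    have h1 := ih fun h hs => hW h (hs.trans (by
      rw [interact]; exact List.suffix_cons _ _))
    have h2 := hW _ (List.suffix_refl _)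
    simp only [interact] at h2 ⊢
    rw [h2, h1]

/-- Whether the environment accepts in an execution whose history belongs to a given class. -/
def accepts (T : ℕ) (P : Party) (e : Bool) (W : History → Data) : Bool :=
  (E.verdict k τ W).toBool && inClass T P e (E.interact k τ W (E.activations k)).1

/-- Worlds that agree along the histories of a class cannot be told apart in this class. -/
theorem accepts_congr {T : ℕ} {P : Party} {e : Bool}
    (hW : ∀ h', inClass T P e h' = true → ∀ h, h <:+ h' → W h = W' h) :
    E.accepts k τ T P e W = E.accepts k τ T P e W' := by
  by_cases h : inClass T P e (E.interact k τ W (E.activations k)).1 = true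
  · rw [accepts, accepts, verdict, verdict, E.interact_congr k τ _ (hW _ h)]
  · by_cases h' : inClass T P e (E.interact k τ W' (E.activations k)).1 = true
    · rw [accepts, accepts, verdict, verdict,
        E.interact_congr k τ _ fun g hg => (hW _ h' g hg).symm]
    · simp [accepts, h, h']

end Environment

/-- The profiles when the run of `π` is known only through the shares `s` of `P` and `s'` of the
other party and the view `v` of `P`; the primed data are those of the other party. -/
def shareProfiles (R : RingFamily) (P : Party) (id : List Bool) (x r s m v x' r' s' : Data) :
    Data :=
  P.pair (profile x r s m v) (profile x' r' s' (R.query .sub id x r) nil)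

/-- Before the erasure only `P` is corrupt, and then the view of the other party does not matter. -/
theorem corruptStates_late {T : ℕ} {P : Party} {h h' : History}
    (hc : inClass T P false h' = true) (hs : h <:+ h') {x r s m v x' r' s' m' w w' : Data}
    (x₁ z₁ x₂ z₂ : Party → Data) :
    corruptStates T (P.pair (profile x r s m v) (profile x' r' s' m' w)) (status T x₁ z₁ h) =
      corruptStates T (P.pair (profile x r s m v) (profile x' r' s' m' w')) (status T x₂ z₂ h) := by
  obtain ⟨hf, he⟩ := inClass_iff.1 hc
  refine corruptStates_congr _ _ _ _ fun Q hQ => ?_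
  have hP := isCorrupt_first ((firstB_of_suffix hs hQ).symm.trans hf) hQ
  rcases P.eq_or_eq_other Q with rfl | rfl
  · simp
  · rw [Party.proj_other_pair, Party.proj_other_pair]
    refine profileState_erased (Nat.lt_of_not_le fun hT => ?_) ..
    have := early_mono hs (early_of_isCorrupt' hP hQ hT)
    rw [he] at this
    cases this

theorem observation_late {T : ℕ} {P : Party} {h h' : History} {id : List Bool}
    (hc : inClass T P false h' = true) (hs : h <:+ h') {x r s m v x' r' s' m' w w' : Data}
    (x₁ z₁ x₂ z₂ : Party → Data) :
    observation R T id (P.pair (profile x r s m v) (profile x' r' s' m' w)) (status T x₁ z₁ h) =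
      observation R T id (P.pair (profile x r s m v) (profile x' r' s' m' w'))
        (status T x₂ z₂ h) := by
  rw [observation_status, observation_status, corruptStates_late hc hs]
  congr 2
  funext Q
  cases P <;> cases Q <;> rfl

theorem proj_corruption {T : ℕ} {x z : Party → Data} {h : History} {P : Party}
    (hP : h.isCorrupt P = true) :
    P.proj (cons (Status.corruptA (status T x z h)) (Status.corruptB (status T x z h))) =
      simEvent x z (.corrupt P) := by
  rw [Status.corruptA_status, Status.corruptB_status]
  cases P <;> simp [Party.proj, corruption, hP]

/-- The report of the simulator is determined by the profiles that it uses when `P` is the first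
corrupt party. -/
theorem idealWorld_adaptiveSim {S : SpecialSim} {k : ℕ} {id : List Bool} {σ : Data}
    {x z : Party → Data} {h h' : History} {P : Party} (hs : h <:+ h') (hP : firstB h' = P.bit) :
    idealWorld (adaptiveSim R S π) (π.rounds k id + 2) k id σ x z h =
      cons (corruptStates (π.rounds k id)
          (simProfiles R S π P k id (cons σ (status (π.rounds k id) x z h)))
          (status (π.rounds k id) x z h))
        (h.outputs (π.rounds k id + 2) z) := by
  rw [idealWorld]
  simp only [adaptiveSim, fst_cons, snd_cons, Status.ofEvents_map, Status.firstB_status, toBool_bit]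
  congr 1
  refine corruptStates_congr _ _ _ _ fun Q hQ => ?_
  rw [← firstB_of_suffix hs hQ, hP]
  cases P <;> simp [Party.bit]

theorem proj_simEvent (x z : Party → Data) (P : Party) :
    (simEvent x z (.corrupt P)).snd.fst = x P ∧ (simEvent x z (.corrupt P)).snd.snd.fst = z P :=
  ⟨rfl, rfl⟩

/-- If both parties are corrupt early, the environment sees the simulated run. -/
theorem idealWorld_early {S : SpecialSim} {k : ℕ} {id : List Bool} {r m c ss : Data}
    {x z x' z' : Party → Data} {h h' : History} {P : Party}
    (hc : inClass (π.rounds k id) P true h' = true) (hs : h <:+ h') :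
    let s := R.query .sub id (z P) (correction R P id (x P) r m)
    let ch := S.choose P k id (list [r, s, cons c ss])
    idealWorld (adaptiveSim R S π) (π.rounds k id + 2) k id (cons c (cons r (cons m ss))) x z h =
      observation R (π.rounds k id) id (execProfiles R π k id (cons (cons (x .A) (x .B))
        (cons (cons (P.pair r ch.fst).fst ch.snd.fst) (cons (P.pair r ch.fst).snd ch.snd.snd))))
        (status (π.rounds k id) x' z' h) := by
  intro s ch
  obtain ⟨hf, he⟩ := inClass_iff.1 hc
  rw [idealWorld_adaptiveSim hs hf, observation_status]
  congr 1
  · refine corruptStates_congr _ _ _ _ fun Q hQ => ?_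
    have hP := isCorrupt_first ((firstB_of_suffix hs hQ).symm.trans hf) hQ
    simp only [simProfiles, Status.early_status, toBool_bit, proj_corruption hP, proj_simEvent,
      fst_cons, snd_cons]
    by_cases hh : early (π.rounds k id) h = true
    · rw [if_pos hh, proj_corruption (isCorrupt_of_early hh P.other), (proj_simEvent x z _).1]
      cases P <;> rfl
    · have hT : advances h ≤ π.rounds k id := by
        by_contra hT
        exact hh (early_of_suffix hs he (by omega))
      rcases P.eq_or_eq_other Q with rfl | rfl
      · rw [if_neg hh, Party.proj_pair, profileState_run hT]
        cases Q <;> simp only [execProfiles, Party.proj, Party.pair, fst_cons, snd_cons] <;>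
          rw [profileState_run hT] <;> rfl
      · exact absurd (early_of_isCorrupt' hP hQ hT) hh
  · exact outputs_eq_of_early hs he _ _

/-- If the other party is not corrupt early, the environment sees nothing of the simulated run but
the view of `P`. -/
theorem idealWorld_late {S : SpecialSim} {k : ℕ} {id : List Bool} {r m c ss : Data}
    {x z x' z' : Party → Data} {h h' : History} {P : Party}
    (hc : inClass (π.rounds k id) P false h' = true) (hs : h <:+ h') :
    let s := R.query .sub id (z P) (correction R P id (x P) r m)
    let ch := S.choose P k id (list [r, s, cons c ss])
    let v := P.proj (π.views k id
      (cons (cons (P.pair r ch.fst).fst ch.snd.fst) (cons (P.pair r ch.fst).snd ch.snd.snd)))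
    let r' := R.query .sub id (x P.other) m
    let s' := R.query .sub id (z P.other)
      (correction R P.other id (x P.other) r' (R.query .sub id (x P) r))
    let p := shareProfiles R P id (x P) r s m v (x P.other) r' s'
    (∀ Q, profileOut R Q id (Q.proj p) = z Q) →
    idealWorld (adaptiveSim R S π) (π.rounds k id + 2) k id (cons c (cons r (cons m ss))) x z h =
      observation R (π.rounds k id) id p (status (π.rounds k id) x' z' h) := by
  intro s ch v r' s' p hout
  obtain ⟨hf, he⟩ := inClass_iff.1 hc
  rw [idealWorld_adaptiveSim hs hf, observation_status, funext hout]
  congr 1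
  refine corruptStates_congr _ _ _ _ fun Q hQ => ?_
  have hP := isCorrupt_first ((firstB_of_suffix hs hQ).symm.trans hf) hQ
  have hh : ¬ early (π.rounds k id) h = true := fun hh => by
    rw [early_mono hs hh] at he; cases he
  simp only [simProfiles, Status.early_status, toBool_bit, proj_corruption hP, proj_simEvent,
    fst_cons, snd_cons, p, shareProfiles, if_neg hh]
  rcases P.eq_or_eq_other Q with rfl | rfl
  · rw [Party.proj_pair, Party.proj_pair]
    cases Q <;> rfl
  · simp only [Party.proj_other_pair, proj_corruption hQ, proj_simEvent]
    rfl

end Worlds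

/-! ### Averages over finite types -/
section Averages

open History
variable {R : RingFamily}

section Avg

variable {α β : Type} [Fintype α] [Fintype β]

/-- The expectation of `f` under the uniform distribution. -/
def avg (f : α → ℝ) : ℝ := (∑ a, f a) / Fintype.card α

theorem avg_add (f g : α → ℝ) : (avg fun a => f a + g a) = avg f + avg g := by
  simp only [avg, Finset.sum_add_distrib, add_div]

theorem avg_sub (f g : α → ℝ) : (avg fun a => f a - g a) = avg f - avg g := by
  simp only [avg, Finset.sum_sub_distrib, sub_div]

theorem avg_mono {f g : α → ℝ} (h : ∀ a, f a ≤ g a) : avg f ≤ avg g :=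
  div_le_div_of_nonneg_right (Finset.sum_le_sum fun a _ => h a) (Nat.cast_nonneg _)

theorem abs_avg_le (f : α → ℝ) : |avg f| ≤ avg fun a => |f a| := by
  rw [avg, abs_div, Nat.abs_cast]
  exact div_le_div_of_nonneg_right (Finset.abs_sum_le_sum_abs _ _) (Nat.cast_nonneg _)

@[simp] theorem avg_const [Nonempty α] (c : ℝ) : (avg fun _ : α => c) = c := by
  simp [avg]

theorem avg_equiv (e : α ≃ β) (f : β → ℝ) : (avg fun a => f (e a)) = avg f := by
  rw [avg, avg, Fintype.card_congr e, e.sum_comp]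

theorem avg_prod (f : α × β → ℝ) : avg f = avg fun a => avg fun b => f (a, b) := by
  simp only [avg, Fintype.sum_prod_type, Fintype.card_prod, Nat.cast_mul, ← Finset.sum_div]
  rw [div_div, mul_comm]

theorem avg_comm (f : α → β → ℝ) : (avg fun a => avg fun b => f a b) = avg fun b => avg fun a => f a b := by
  have h1 := avg_prod fun p : α × β => f p.1 p.2
  have h2 := avg_prod fun p : β × α => f p.2 p.1
  rw [← h1, ← h2, ← avg_equiv (Equiv.prodComm α β)]
  rfl

/-- Independent samples of the two parties. -/
theorem avg_party (P : Party) (f : α → α → ℝ) :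
    (avg fun a : Party → α => f (a P) (a P.other)) = avg fun a => avg fun b => f a b := by
  let e : (Party → α) ≃ α × α :=
    { toFun a := (a P, a P.other)
      invFun p Q := if Q = P then p.1 else p.2
      left_inv a := by
        funext Q
        rcases P.eq_or_eq_other Q with rfl | rfl <;> simp
      right_inv p := by simp }
  rw [← avg_prod fun p : α × α => f p.1 p.2, ← avg_equiv e]
  rfl

/-- The indicator of an event. -/
def ind (b : Bool) : ℝ := if b = true then 1 else 0

theorem prTrue_pure (d : Data) : prTrue (PMF.pure d) = ind d.toBool := by
  rw [prTrue, PMF.pure_map, PMF.pure_apply, ind]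
  cases d.toBool <;> simp

theorem prTrue_unif_bind [Nonempty α] (F : α → PMF Data) :
    prTrue ((unif α).bind F) = avg fun a => prTrue (F a) := by
  simp only [prTrue, PMF.map_bind, PMF.bind_apply, tsum_fintype, unif,
    PMF.uniformOfFintype_apply, avg]
  rw [ENNReal.toReal_sum fun a _ => ENNReal.mul_ne_top (by simp) (PMF.apply_ne_top _ _),
    Finset.sum_div]
  refine Finset.sum_congr rfl fun a _ => ?_
  rw [ENNReal.toReal_mul, ENNReal.toReal_inv, ENNReal.toReal_natCast, mul_comm, div_eq_mul_inv]

end Avg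

section Shares

variable {α : Type} [NonUnitalRing α]

/-- The shares of `c` when the share of `P` is `y`. -/
def shares (P : Party) (c y : α) : Party → α := fun Q => if Q = P then y else c - y

@[simp] theorem shares_self (P : Party) (c y : α) : shares P c y P = y := by simp [shares]

@[simp] theorem shares_other (P : Party) (c y : α) : shares P c y P.other = c - y := by
  simp [shares]

/-- The contribution of the correction `m` to the output of a party. -/
def correctionTerm (P : Party) (x r m : α) : α :=
  match P with
  | .A => x * m
  | .B => m * r

/-- The shares of `x A * x B` and those of `r A * r B` differ by the correction terms. -/
theorem sub_correctionTerm_other (P : Party) (x r : Party → α) (y : α) :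
    x .A * x .B - y - correctionTerm P.other (x P.other) (r P.other) (x P - r P) =
      r .A * r .B - (y - correctionTerm P (x P) (r P) (x P.other - r P.other)) := by
  cases P <;> simp only [correctionTerm, Party.other, mul_sub, sub_mul] <;> abel

variable [Fintype α]

theorem avg_shares (P : Party) (c : α) (F : (Party → α) → ℝ) :
    (avg fun y => F (shares .A c y)) = avg fun y => F (shares P c y) := by
  cases P with
  | A => rfl
  | B =>
    rw [← avg_equiv (Equiv.subLeft c)]
    congr 1
    funext y
    congr 1
    funext Q
    cases Q <;> simp [shares]

theorem prTrue_pdtShr_bind (P : Party) (R : RingFamily) (id : List Bool) (a b : R.Carrier id)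
    (F : (Party → R.Carrier id) → PMF Data) :
    prTrue ((pdtShr R id a b).bind F) = avg fun y => prTrue (F (shares P (a * b) y)) := by
  rw [pdtShr, PMF.bind_map, prTrue_unif_bind, ← avg_shares P (a * b) fun z => prTrue (F z)]
  congr 1
  funext y
  simp only [Function.comp]
  congr 2
  funext Q
  cases Q <;> simp [shares]

/-- When the input of `P` is `x` and that of the other party is `x'`: a uniform output of `P`, a
uniform random input of `P` and a uniform correction amount to uniform random inputs of both
parties and a uniform share of `P` in the run of the protocol. -/
theorem avg_reparametrize (P : Party) (x x' : α) (F : (Party → α) → α → ℝ) :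
    (avg fun y => avg fun r => avg fun m => F (shares P (r + (x' - m)) r)
      (y - correctionTerm P x r m)) = avg fun r : Party → α => avg fun s => F r s := by
  have h1 (r m : α) : (avg fun y => F (shares P (r + (x' - m)) r) (y - correctionTerm P x r m)) =
      avg fun s => F (shares P (r + (x' - m)) r) s :=
    avg_equiv (Equiv.subRight (correctionTerm P x r m))
      fun s => F (shares P (r + (x' - m)) r) s
  have h2 (r : α) : (avg fun m => avg fun s => F (shares P (r + (x' - m)) r) s) =
      avg fun m => avg fun s => F (shares P (r + m) r) s :=
    avg_equiv (Equiv.subLeft x') fun m => avg fun s => F (shares P (r + m) r) s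
  refine (avg_comm _).trans ((congrArg avg (funext fun r => (avg_comm _).trans
    ((congrArg avg (funext (h1 r))).trans (h2 r)))).trans ?_)
  rw [← avg_party P fun a b => avg fun s => F (shares P (a + b) a) s]
  congr 1
  funext r
  congr 1
  funext s
  congr 1
  funext Q
  rcases P.eq_or_eq_other Q with rfl | rfl <;> simp

end Shares

section Tapes

variable {id : List Bool} {c s : ℕ}

/-- A tape with one more ring element, which comes first. -/
def Tape.push (a : R.Carrier id) (t : Tape R id c s) : Tape R id c (s + 1) :=
  (t.1, Fin.cons a t.2)

theorem Tape.enc_push (a : R.Carrier id) (t : Tape R id c s) :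
    (t.push a).enc = cons t.enc.fst (cons (R.elt id a) t.enc.snd) := by
  simp [Tape.enc, Tape.push, List.ofFn_succ, list]

/-- Splitting off the first ring element of a tape. -/
def Tape.splitEquiv : R.Carrier id × Tape R id c s ≃ Tape R id c (s + 1) where
  toFun p := p.2.push p.1
  invFun t := (t.2 0, (t.1, Fin.tail t.2))
  left_inv p := by simp [Tape.push]
  right_inv t := by simp [Tape.push]

theorem avg_tape_succ (F : Tape R id c (s + 1) → ℝ) :
    avg F = avg fun a => avg fun t : Tape R id c s => F (t.push a) := by
  rw [← avg_equiv Tape.splitEquiv, avg_prod]; rfl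

theorem avg_tapes_succ (F : (Party → Tape R id c (s + 1)) → ℝ) :
    avg F = avg fun a : Party → R.Carrier id => avg fun t : Party → Tape R id c s =>
      F fun P => (t P).push (a P) := by
  rw [← avg_equiv ((Equiv.arrowProdEquivProdArrow Party _ _).symm.trans
    (Equiv.piCongrRight fun _ => Tape.splitEquiv)), avg_prod]
  rfl

theorem Data.list_injective : Function.Injective list := by
  intro a
  induction a with
  | nil => intro b h; cases b <;> simp_all [list]
  | cons x a ih =>
    intro b h
    cases b with
    | nil => simp [list] at h
    | cons y b =>
      simp only [list, Data.cons.injEq] at h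
      rw [h.1, ih h.2]

theorem Tape.enc_injective : Function.Injective (Tape.enc : Tape R id c s → Data) := by
  rintro ⟨a, b⟩ ⟨a', b'⟩ h
  simp only [Tape.enc, Data.cons.injEq] at h
  rw [List.ofFn_injective (bits_injective h.1), List.ofFn_injective
    ((R.elt_injective id).list_map (Data.list_injective h.2))]

end Tapes

end Averages

/-! ### Distinguishers that simulate an environment -/
section Distinguishers

open History PolyTime
variable {R : RingFamily} {π : Protocol}

/-- The status in a world without information about inputs and outputs. -/
abbrev bareStatus (T : ℕ) (h : History) : Data := status T (fun _ => nil) (fun _ => nil) h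

/-- The world with given profiles of the parties. -/
def profileWorld (R : RingFamily) (T : ℕ) (id : List Bool) (p : Data) (h : History) : Data :=
  observation R T id p (bareStatus T h)

/-- The event that stands for the request `d`. -/
def requestEvent (d : Data) : Data :=
  if d.toBool = true then
    if d.fst.toBool = true then simEvent (fun _ => nil) (fun _ => nil) (.corrupt .B)
    else simEvent (fun _ => nil) (fun _ => nil) (.corrupt .A)
  else nil

theorem requestEvent_eq (d : Data) :
    requestEvent d = simEvent (fun _ => nil) (fun _ => nil) (Request.decode d) := by
  rcases d with _ | ⟨_ | _, _⟩ <;> rfl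

/-- The interaction of an environment, given by its answers, with a world. -/
def interactWith (ans : Data → Data) (W : History → Data) : ℕ → History × List Data
  | 0 => ([], [W []])
  | n + 1 =>
      let r := interactWith ans W n
      let h : History := Request.decode (ans (list r.2)) :: r.1
      (h, W h :: r.2)

theorem Environment.interact_eq (E : Environment R) (k : ℕ) (τ : Data) (W : History → Data)
    (n : ℕ) : E.interact k τ W n =
      interactWith (fun o => E.act k (E.id k) (list [E.advice k, τ, o])) W n := by
  induction n with
  | zero => rfl
  | succ n ih => rw [interact, ih]; rfl

theorem length_interactWith (ans : Data → Data) (W : History → Data) (n : ℕ) :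
    (interactWith ans W n).1.length = n := by
  induction n with
  | zero => rfl
  | succ n ih => rw [interactWith, List.length_cons, ih]

theorem size_interactWith_le (ans : Data → Data) {W : History → Data} {b n : ℕ}
    (hW : ∀ h : History, h.length ≤ n → (W h).size ≤ b) :
    (list (interactWith ans W n).2).size ≤ 1 + (n + 1) * (1 + b) := by
  induction n with
  | zero =>
    have := hW [] le_rfl
    simp only [interactWith, list, Data.size]; omega
  | succ n ih =>
    have h1 := ih fun h hh => hW h (hh.trans (Nat.le_succ n))
    have h2 := hW (interactWith ans W (n + 1)).1 (length_interactWith ..).le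
    have h3 : (n + 1 + 1) * (1 + b) = (n + 1) * (1 + b) + (1 + b) := by ring
    rw [interactWith] at h2 ⊢
    simp only [list, Data.size] at h2 ⊢
    omega

/-- One activation of an environment in the world with given profiles. The state consists of
`(advice, (tape, profiles))`, the status and the observations. -/
def playStep (R : RingFamily) (act : ℕ → List Bool → Data → Data) (n : ℕ → List Bool → ℕ) (k : ℕ)
    (id : List Bool) (s : Data) : Data :=
  let st := Status.update (n k id) s.snd.fst
    (requestEvent (act k id (list [s.fst.fst, s.fst.snd.fst, s.snd.snd])))
  cons s.fst (cons st (cons (observation R (n k id) id s.fst.snd.snd st) s.snd.snd))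

/-- The state before the first activation. -/
def playStart (R : RingFamily) (n : ℕ → List Bool → ℕ) (k : ℕ) (id : List Bool) (y : Data) :
    Data :=
  cons y (cons (bareStatus (n k id) [])
    (cons (observation R (n k id) id y.snd.snd (bareStatus (n k id) [])) nil))

theorem iterate_playStep (act : ℕ → List Bool → Data → Data) (n : ℕ → List Bool → ℕ) (k : ℕ)
    (id : List Bool) (y : Data) (i : ℕ) :
    (playStep R act n k id)^[i] (playStart R n k id y) =
      let r := interactWith (fun o => act k id (list [y.fst, y.snd.fst, o]))
        (profileWorld R (n k id) id y.snd.snd) i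
      cons y (cons (bareStatus (n k id) r.1) (list r.2)) := by
  induction i with
  | zero => rfl
  | succ i ih =>
    rw [Function.iterate_succ_apply', ih]
    simp only [playStep, fst_cons, snd_cons, requestEvent_eq, bareStatus, update_status]
    rfl

theorem polyTime_play {act : ℕ → List Bool → Data → Data} {n : ℕ → List Bool → ℕ}
    {f g : ℕ → List Bool → Data → Data} (hact : PolyTime R act) (hn : PolyLength R n)
    (hf : PolyTime R f) (hg : PolyTime R g) :
    PolyTime R fun k id x =>
      (playStep R act n k id)^[(f k id x).len] (playStart R n k id (g k id x)) := by
  have hobs := PolyTime.observation hn (fst (R := R) arg) (snd arg)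
  have hstep : PolyTime R (playStep R act n) := by
    have hst : PolyTime R fun k id s => Status.update (n k id) s.snd.fst
        (requestEvent (act k id (list [s.fst.fst, s.fst.snd.fst, s.snd.snd]))) := by
      apply Status.polyTime_update hn (fst (snd arg))
      unfold requestEvent
      simp only [list]
      repeat first
        | exact arg
        | exact const _
        | apply PolyTime.ite
        | apply hact.comp
        | apply PolyTime.cons
        | apply PolyTime.fst
        | apply PolyTime.snd
    exact (fst arg).cons (hst.cons ((PolyTime.observation hn (snd (snd (fst arg))) hst).cons
      (snd (snd arg))))
  have hstart : PolyTime R fun k id x => playStart R n k id (g k id x) := by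
    have hst : PolyTime R fun k id _ => bareStatus (n k id) [] := const (bareStatus 0 [])
    exact hg.cons (hst.cons ((PolyTime.observation hn hg.snd.snd hst).cons nil))
  obtain ⟨q, hq⟩ := hobs.size
  obtain ⟨r, hr⟩ := hg.size
  let b : Polynomial ℕ := q.comp (3 * .X + r + 61)
  refine hstep.loop hf hstart ⟨2 * .X + r + 70 + (1 + (.X + 1) * (1 + b)), fun k id x i => ?_⟩
  rw [iterate_playStep]
  set y := g k id x
  set m := (inp k id x).size + i
  have h1 : y.size ≤ r.eval m := (hr k id x).trans (eval_le_eval r (Nat.le_add_right _ i))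
  have h2 (h : History) (hh : h.length ≤ i) :
      (profileWorld R (n k id) id y.snd.snd h).size ≤ b.eval m := by
    have h3 := hq k id (cons y.snd.snd (bareStatus (n k id) h))
    simp only [fst_cons, snd_cons] at h3
    refine h3.trans ?_
    have h4 : (bareStatus (n k id) h).size ≤ _ := size_status_le (n k id) h
    have h5 := size_snd_le y
    have h6 := size_snd_le y.snd
    have h7 := size_inp k id x
    have h8 := Data.size_pos x
    simp only [b, Polynomial.eval_comp, Polynomial.eval_add, Polynomial.eval_mul,
      Polynomial.eval_X, Polynomial.eval_ofNat]
    refine eval_le_eval q ?_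
    rw [size_inp, Data.size]
    omega
  have h3 := size_interactWith_le (fun o => act k id (list [y.fst, y.snd.fst, o])) h2
  have h4 : (bareStatus (n k id) (interactWith (fun o => act k id (list [y.fst, y.snd.fst, o]))
    (profileWorld R (n k id) id y.snd.snd) i).1).size ≤ _ := size_status_le _ _
  rw [length_interactWith] at h4
  have h5 : (i + 1) * (1 + b.eval m) ≤ (m + 1) * (1 + b.eval m) :=
    Nat.mul_le_mul_right _ (by omega)
  simp only [Data.size, Polynomial.eval_add, Polynomial.eval_mul, Polynomial.eval_X,
    Polynomial.eval_ofNat, Polynomial.eval_one]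
  omega

/-- The inputs of the parties, as a function of the advice and the tape of an environment. -/
theorem Environment.exists_inputs {s : Setting} (E : Environment R) (hE : E.Admissible s) :
    ∃ f : ℕ → List Bool → Data → Data,
      (∀ k τ, f k (E.id k) (list [E.advice k, Tape.enc τ]) =
        cons (R.elt (E.id k) (E.inputs k τ .A)) (R.elt (E.id k) (E.inputs k τ .B))) ∧
      (s = .computational → PolyTime R f) := by
  cases s with
  | computational => exact hE.2.1.imp fun f hf => ⟨hf.2, fun _ => hf.1⟩
  | statistical =>
    refine ⟨fun k _ => Function.extend (fun τ => list [E.advice k, Tape.enc τ]) (fun τ =>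
      cons (R.elt (E.id k) (E.inputs k τ .A)) (R.elt (E.id k) (E.inputs k τ .B))) fun _ => nil,
      fun k τ => ?_, nofun⟩
    refine Function.Injective.extend_apply (fun τ τ' h => ?_) _ _ _
    simp only [list, Data.cons.injEq] at h
    exact Tape.enc_injective h.2.1

/-- The distinguisher that simulates the environment `E` in the world of the profiles that `prep`
computes from the inputs of the parties and the sample. It accepts if the environment does so, the
history belongs to the class given by `P` and `e`, and the component `guard` of the sample is true.
The inputs are computed by `f`; the advice contains the number of activations. -/
def classDistinguisher (E : Environment R) (n : ℕ → List Bool → ℕ)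
    (f prep : ℕ → List Bool → Data → Data) (guard : Data → Data) (P : Party) (e : Bool) :
    Distinguisher where
  id := E.id
  advice k := cons (unary (E.activations k)) (E.advice k)
  coins := E.coins
  samples := E.samples
  decide k id x :=
    let y := cons x.fst.snd (cons x.snd.fst
      (prep k id (cons (f k id (list [x.fst.snd, x.snd.fst])) x.snd.snd.fst)))
    let s := (playStep R E.act n k id)^[x.fst.fst.len] (playStart R n k id y)
    if (guard x.snd.snd.fst).toBool = true then
      if (Status.firstB s.snd.fst).toBool = true then
        if (Status.early s.snd.fst).toBool = true then
          if (bit P.bit).toBool = true then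
            if (bit e).toBool = true then E.act k id (list [x.fst.snd, x.snd.fst, s.snd.snd])
            else nil
          else nil
        else
          if (bit P.bit).toBool = true then
            if (bit e).toBool = true then nil
            else E.act k id (list [x.fst.snd, x.snd.fst, s.snd.snd])
          else nil
      else
        if (Status.early s.snd.fst).toBool = true then
          if (bit P.bit).toBool = true then nil
          else
            if (bit e).toBool = true then E.act k id (list [x.fst.snd, x.snd.fst, s.snd.snd])
            else nil
        else
          if (bit P.bit).toBool = true then nil
          else
            if (bit e).toBool = true then nil
            else E.act k id (list [x.fst.snd, x.snd.fst, s.snd.snd])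
    else nil

section Distinguishers

variable {E : Environment R} {n : ℕ → List Bool → ℕ} {f prep : ℕ → List Bool → Data → Data}
  {guard : Data → Data} {P : Party} {e : Bool}

theorem classDistinguisher_decide
    (hf : ∀ k τ, f k (E.id k) (list [E.advice k, Tape.enc τ]) =
      cons (R.elt (E.id k) (E.inputs k τ .A)) (R.elt (E.id k) (E.inputs k τ .B)))
    (k : ℕ) (τ : Tape R (E.id k) (E.coins k) (E.samples k)) (smp : Data) :
    ((classDistinguisher E n f prep guard P e).decide k (E.id k)
      (list [(classDistinguisher E n f prep guard P e).advice k, τ.enc, smp])).toBool =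
    ((guard smp).toBool && E.accepts k τ.enc (n k (E.id k)) P e
      (profileWorld R (n k (E.id k)) (E.id k) (prep k (E.id k)
        (cons (cons (R.elt (E.id k) (E.inputs k τ .A)) (R.elt (E.id k) (E.inputs k τ .B)))
          smp)))) := by
  have hf' := hf k τ
  simp only [list] at hf'
  simp only [classDistinguisher, list, fst_cons, snd_cons, iterate_playStep, hf', len_unary,
    Environment.accepts, Environment.verdict, Environment.interact_eq, Environment.answer,
    Status.firstB_status, Status.early_status, toBool_bit, inClass]
  set r := interactWith _ _ (E.activations k)
  cases (guard smp).toBool <;> cases firstB r.1 <;> cases early (n k (E.id k)) r.1 <;> cases e <;>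
    cases P <;> simp [Party.bit]

theorem classDistinguisher_admissible {s : Setting} (hE : E.Admissible s) (hn : PolyLength R n)
    (hf : s = .computational → PolyTime R f) (hprep : PolyTime R prep)
    (hguard : PolyTime R fun _ _ => guard) :
    (classDistinguisher E n f prep guard P e).Admissible R s := by
  cases s with
  | statistical => trivial
  | computational =>
    obtain ⟨hact, -, q, hq⟩ := hE
    refine ⟨?_, 3 * q + 5, fun k => ?_⟩
    · have hplay := polyTime_play (R := R) (f := fun _ _ x => x.fst.fst)
        (g := fun k id x => cons x.fst.snd (cons x.snd.fst
          (prep k id (cons (f k id (list [x.fst.snd, x.snd.fst])) x.snd.snd.fst))))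
        hact hn (fst (fst arg)) ((snd (fst arg)).cons ((fst (snd arg)).cons (hprep.comp
          (((hf rfl).comp ((snd (fst arg)).cons ((fst (snd arg)).cons nil))).cons
            (fst (snd (snd arg)))))))
      have hg : PolyTime R fun _ _ x => guard x.snd.snd.fst := hguard.comp (fst (snd (snd arg)))
      have ha := hact.comp ((snd (fst arg)).cons ((fst (snd arg)).cons (hplay.snd.snd.cons nil)))
      have hB := hplay.snd.fst.snd.snd.fst
      have he := hplay.snd.fst.snd.snd.snd.fst
      exact hg.ite (hB.ite
        (he.ite ((const _).ite ((const _).ite ha nil) nil) ((const _).ite ((const _).ite nil ha) nil))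
        (he.ite ((const _).ite nil ((const _).ite ha nil))
          ((const _).ite nil ((const _).ite nil ha)))) nil
    · obtain ⟨h1, h2, h3, h4, h5⟩ := hq k
      simp only [classDistinguisher, Data.size, size_unary, Polynomial.eval_add,
        Polynomial.eval_mul, Polynomial.eval_ofNat]
      refine ⟨?_, ?_, ?_, ?_⟩ <;> omega

end Distinguishers

/-- The distinguisher that recognizes that the special simulator has aborted. -/
def abortDistinguisher (id : ℕ → List Bool) : Distinguisher where
  id := id
  advice _ := nil
  coins _ := 0
  samples _ := 0
  decide _ _ x := if x.snd.snd.fst.snd.snd.fst.toBool = true then nil else bit true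

theorem abortDistinguisher_admissible {E : Environment R} {s : Setting} (hE : E.Admissible s) :
    (abortDistinguisher E.id).Admissible R s := by
  cases s with
  | statistical => trivial
  | computational =>
    obtain ⟨-, -, q, hq⟩ := hE
    refine ⟨?_, q + 1, fun k => ?_⟩
    · exact (fst (snd (snd (fst (snd (snd arg)))))).ite nil (const _)
    · have := (hq k).1
      simp only [abortDistinguisher, Data.size, Polynomial.eval_add, Polynomial.eval_one]
      refine ⟨?_, ?_, ?_, ?_⟩ <;> omega

end Distinguishers

/-! ### Acceptance probabilities as averages -/
section Probabilities

open History
variable {R : RingFamily} {π : Protocol} {S : SpecialSim}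

namespace Distinguisher

variable (D : Distinguisher) (k : ℕ)

theorem prob_pure (d : Data) : D.prob R k (PMF.pure d) =
    avg fun τ : Tape R (D.id k) (D.coins k) (D.samples k) =>
      ind (D.decide k (D.id k) (list [D.advice k, τ.enc, d])).toBool := by
  change prTrue ((PMF.pure d).bind fun x => (unif _).bind fun τ => PMF.pure _) = _
  rw [PMF.pure_bind, prTrue_unif_bind]
  simp only [prTrue_pure]

theorem prob_unif_bind {α : Type} [Fintype α] [Nonempty α] (F : α → PMF Data) :
    D.prob R k ((unif α).bind F) = avg fun a => D.prob R k (F a) := by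
  change prTrue (((unif α).bind F).bind _) = _
  rw [PMF.bind_bind, prTrue_unif_bind]
  rfl

theorem prob_pdtShr_bind (P : Party) (id : List Bool) (a b : R.Carrier id)
    (F : (Party → R.Carrier id) → PMF Data) :
    D.prob R k ((pdtShr R id a b).bind F) =
      avg fun y => D.prob R k (F (shares P (a * b) y)) := by
  change prTrue (((pdtShr R id a b).bind F).bind _) = _
  rw [PMF.bind_bind, prTrue_pdtShr_bind P]
  rfl

end Distinguisher

theorem Tape.enc_eq {id : List Bool} {c s : ℕ} (t : Tape R id c s) :
    cons t.enc.fst t.enc.snd = t.enc := rfl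

theorem correction_elt (P : Party) (id : List Bool) (x r m : R.Carrier id) :
    correction R P id (R.elt id x) (R.elt id r) (R.elt id m) =
      R.elt id (correctionTerm P x r m) := by
  cases P <;> exact R.query_elt ..

theorem profileOut_profile (P : Party) (id : List Bool) (x r s m v : Data) :
    profileOut R P id (profile x r s m v) = R.query .add id (correction R P id x r m) s := by
  cases P <;> rfl

theorem ind_verdict (E : Environment R) (k : ℕ) (τ : Data) (T : ℕ) (W : History → Data) :
    ind (E.verdict k τ W).toBool =
      ind (E.accepts k τ T .A true W) + ind (E.accepts k τ T .A false W) +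
      (ind (E.accepts k τ T .B true W) + ind (E.accepts k τ T .B false W)) := by
  simp only [Environment.accepts, inClass]
  cases (E.verdict k τ W).toBool <;>
    cases firstB (E.interact k τ W (E.activations k)).1 <;>
    cases early T (E.interact k τ W (E.activations k)).1 <;> simp [ind, Party.bit]

/-- The pair of the inputs of the parties. -/
def Environment.inputPair (E : Environment R) (k : ℕ)
    (τ : Tape R (E.id k) (E.coins k) (E.samples k)) : Data :=
  cons (R.elt (E.id k) (E.inputs k τ .A)) (R.elt (E.id k) (E.inputs k τ .B))

/-- The acceptance probability, in one class of histories, in a world of profiles that depend on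
the inputs of the parties. -/
def classProb (E : Environment R) (π : Protocol) (P : Party) (e : Bool) (k : ℕ)
    (p : Data → Data) : ℝ :=
  avg fun τ : Tape R (E.id k) (E.coins k) (E.samples k) =>
    ind (E.accepts k τ.enc (π.rounds k (E.id k)) P e
      (profileWorld R (π.rounds k (E.id k)) (E.id k) (p (E.inputPair k τ))))

/-- The profiles in a run of `π` on random inputs `r` with tapes `ω`. -/
def realProfiles (R : RingFamily) (π : Protocol) (k : ℕ) (id : List Bool)
    (r : Party → R.Carrier id) (ω : Party → π.PTape R k id) (x : Data) : Data :=
  execProfiles R π k id (cons x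
    (cons (cons (R.elt id (r .A)) (ω .A).enc) (cons (R.elt id (r .B)) (ω .B).enc)))

/-- Inputs and tapes of both parties in the run that the special simulator chooses for `P`. -/
def simRun (S : SpecialSim) (P : Party) (k : ℕ) (id : List Bool)
    (r s : R.Carrier id) (σ : S.STape R k id) : Data :=
  cons (cons (P.pair (R.elt id r) (S.choice R P k id r s σ).fst).fst
      (S.choice R P k id r s σ).snd.fst)
    (cons (P.pair (R.elt id r) (S.choice R P k id r s σ).fst).snd
      (S.choice R P k id r s σ).snd.snd)

/-- The profiles in the ideal execution when `P` is the first corrupt party, in terms of the random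
inputs `r` and the share `s` of `P`; they depend on whether both parties are corrupt early. -/
def idealProfiles (R : RingFamily) (π : Protocol) (S : SpecialSim) (P : Party) (k : ℕ)
    (id : List Bool) (r : Party → R.Carrier id) (s : R.Carrier id) (σ : S.STape R k id) :
    Bool → Data → Data
  | true, x => execProfiles R π k id (cons x (simRun S P k id (r P) s σ))
  | false, x =>
      shareProfiles R P id (P.proj x) (R.elt id (r P)) (R.elt id s)
        (R.query .sub id (P.other.proj x) (R.elt id (r P.other)))
        (P.proj (π.views k id (simRun S P k id (r P) s σ)))
        (P.other.proj x) (R.elt id (r P.other)) (R.elt id (r .A * r .B - s))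

/-- The real execution, in one class of histories. -/
def realClass (E : Environment R) (π : Protocol) (P : Party) (e : Bool) (k : ℕ) : ℝ :=
  avg fun r : Party → R.Carrier (E.id k) => avg fun ω : Party → π.PTape R k (E.id k) =>
    classProb E π P e k (realProfiles R π k (E.id k) r ω)

/-- The ideal execution, in one class of histories. -/
def idealClass (E : Environment R) (π : Protocol) (S : SpecialSim) (P : Party) (e : Bool)
    (k : ℕ) : ℝ :=
  avg fun r : Party → R.Carrier (E.id k) => avg fun s : R.Carrier (E.id k) =>
    avg fun σ : S.STape R k (E.id k) =>
      classProb E π P e k (idealProfiles R π S P k (E.id k) r s σ e)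

theorem prTrue_real (E : Environment R) (k : ℕ) :
    prTrue (E.real (derandomized R π) k) =
      realClass E π .A true k + realClass E π .A false k +
      (realClass E π .B true k + realClass E π .B false k) := by
  have h1 (P : Party) (e : Bool) : realClass E π P e k =
      avg fun τ : Tape R (E.id k) (E.coins k) (E.samples k) =>
        avg fun r : Party → R.Carrier (E.id k) => avg fun ω : Party → π.PTape R k (E.id k) =>
          ind (E.accepts k τ.enc (π.rounds k (E.id k)) P e
            (profileWorld R (π.rounds k (E.id k)) (E.id k)
              (realProfiles R π k (E.id k) r ω (E.inputPair k τ)))) := by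
    refine Eq.trans (congrArg avg (funext fun r => ?_)) (avg_comm _)
    exact avg_comm _
  have h2 : prTrue (E.real (derandomized R π) k) =
      avg fun τ : Tape R (E.id k) (E.coins k) (E.samples k) =>
        avg fun r : Party → R.Carrier (E.id k) => avg fun ω : Party → π.PTape R k (E.id k) =>
          ind (E.verdict k τ.enc (profileWorld R (π.rounds k (E.id k)) (E.id k)
              (realProfiles R π k (E.id k) r ω (E.inputPair k τ)))).toBool := by
    change prTrue ((unif _).bind fun τ => (unif _).bind fun ω => PMF.pure _) = _
    rw [prTrue_unif_bind]
    refine congrArg avg (funext fun τ => ?_)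
    rw [prTrue_unif_bind]
    refine (avg_tapes_succ _).trans ?_
    refine congrArg avg (funext fun r => congrArg avg (funext fun ω => ?_))
    rw [prTrue_pure]
    congr 3
    funext h
    have h3 : (fun P => ((ω P).push (r P)).enc) = fun P => cons (ω P).enc.fst
        (cons (R.elt (E.id k) (r P)) (ω P).enc.snd) := funext fun P => Tape.enc_push ..
    refine (congrArg (fun ω' => realWorld (derandomized R π) k (E.id k) _ ω' h) h3).trans ?_
    exact realWorld_derandomized k (E.id k) _ (fun P => R.elt _ (r P)) (fun P => (ω P).enc.fst)
      (fun P => (ω P).enc.snd) _ _ h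
  rw [h2]
  simp only [h1, ← avg_add]
  refine congrArg avg (funext fun τ => congrArg avg (funext fun r => congrArg avg
    (funext fun ω => ?_)))
  exact ind_verdict ..

/-- With the inputs of the parties fixed, the ideal execution in one class of histories amounts to
random inputs and random shares in a run of `π`. -/
theorem avg_idealWorld (E : Environment R) (P : Party) (e : Bool) (k : ℕ)
    (τ : Tape R (E.id k) (E.coins k) (E.samples k)) :
    (avg fun y : R.Carrier (E.id k) => avg fun σ : (adaptiveSim R S π).STape R k (E.id k) =>
      ind (E.accepts k τ.enc (π.rounds k (E.id k)) P e
        (idealWorld (adaptiveSim R S π) (π.rounds k (E.id k) + 2) k (E.id k) σ.enc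
          (fun Q => R.elt _ (E.inputs k τ Q))
          fun Q => R.elt _ (shares P (E.inputs k τ .A * E.inputs k τ .B) y Q)))) =
    avg fun r : Party → R.Carrier (E.id k) => avg fun s : R.Carrier (E.id k) =>
      avg fun σ : S.STape R k (E.id k) =>
        ind (E.accepts k τ.enc (π.rounds k (E.id k)) P e
          (profileWorld R (π.rounds k (E.id k)) (E.id k)
            (idealProfiles R π S P k (E.id k) r s σ e (E.inputPair k τ)))) := by
  refine Eq.trans ?_ (avg_reparametrize P (E.inputs k τ P) (E.inputs k τ P.other) fun r s =>
    avg fun σ : S.STape R k (E.id k) => ind (E.accepts k τ.enc (π.rounds k (E.id k)) P e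
      (profileWorld R (π.rounds k (E.id k)) (E.id k)
        (idealProfiles R π S P k (E.id k) r s σ e (E.inputPair k τ)))))
  refine congrArg avg (funext fun y => (avg_tape_succ _).trans (congrArg avg (funext fun r =>
    (avg_tape_succ _).trans (congrArg avg (funext fun m => congrArg avg (funext fun σ => ?_))))))
  have h3 : ((Tape.push m (σ : S.STape R k (E.id k))).push r).enc =
      cons σ.enc.fst (cons (R.elt (E.id k) r) (cons (R.elt (E.id k) m) σ.enc.snd)) := by
    rw [Tape.enc_push, Tape.enc_push, fst_cons, snd_cons]
  refine (congrArg (fun d => ind (E.accepts k τ.enc (π.rounds k (E.id k)) P e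
    (idealWorld (adaptiveSim R S π) (π.rounds k (E.id k) + 2) k (E.id k) d _ _))) h3).trans ?_
  congr 1
  refine E.accepts_congr k _ fun h' hc h hs => ?_
  have hproj (Q : Party) : Q.proj (E.inputPair k τ) = R.elt (E.id k) (E.inputs k τ Q) := by cases Q <;> rfl
  cases e with
  | true =>
    refine (idealWorld_early (x' := fun _ => nil) (z' := fun _ => nil) hc hs).trans ?_
    simp only [shares_self, correction_elt, R.query_elt, RingOp.apply, Tape.enc_eq, idealProfiles]
    rfl
  | false =>
    have hid : E.inputs k τ .A * E.inputs k τ .B - y -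
        correctionTerm P.other (E.inputs k τ P.other) (E.inputs k τ P.other - m) (E.inputs k τ P - r) =
        shares P (r + (E.inputs k τ P.other - m)) r .A * shares P (r + (E.inputs k τ P.other - m)) r .B -
          (y - correctionTerm P (E.inputs k τ P) r m) := by
      have := sub_correctionTerm_other P (E.inputs k τ) (shares P (r + (E.inputs k τ P.other - m)) r) y
      simpa using this
    refine (idealWorld_late (x' := fun _ => nil) (z' := fun _ => nil) hc hs ?_).trans ?_
    · intro Q
      simp only [shareProfiles, shares_self, shares_other, correction_elt, R.query_elt,
        RingOp.apply]
      rcases P.eq_or_eq_other Q with rfl | rfl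
      · rw [Party.proj_pair, profileOut_profile, correction_elt, R.query_elt]
        simp [RingOp.apply]
      · rw [Party.proj_other_pair, profileOut_profile, correction_elt, R.query_elt]
        simp [RingOp.apply]
    · simp only [shares_self, shares_other, correction_elt, R.query_elt, RingOp.apply,
        Tape.enc_eq, hid, idealProfiles, hproj, profileWorld, bareStatus]
      congr 2
      · simp
      · simp

theorem prTrue_ideal (E : Environment R) (k : ℕ) :
    prTrue (E.ideal (adaptiveSim R S π) (derandomized R π).rounds k) =
      idealClass E π S .A true k + idealClass E π S .A false k +
      (idealClass E π S .B true k + idealClass E π S .B false k) := by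
  have h1 (P : Party) (e : Bool) : idealClass E π S P e k =
      avg fun τ : Tape R (E.id k) (E.coins k) (E.samples k) =>
        avg fun y : R.Carrier (E.id k) => avg fun σ : (adaptiveSim R S π).STape R k (E.id k) =>
          ind (E.accepts k τ.enc (π.rounds k (E.id k)) P e
            (idealWorld (adaptiveSim R S π) (π.rounds k (E.id k) + 2) k (E.id k) σ.enc
              (fun Q => R.elt _ (E.inputs k τ Q))
              fun Q => R.elt _ (shares .A (E.inputs k τ .A * E.inputs k τ .B) y Q))) := by
    refine Eq.trans ?_ (congrArg avg (funext fun τ => (avg_idealWorld E P e k τ).symm.trans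
      (avg_shares P _ fun z => avg fun σ : (adaptiveSim R S π).STape R k (E.id k) =>
        ind (E.accepts k τ.enc (π.rounds k (E.id k)) P e
          (idealWorld (adaptiveSim R S π) (π.rounds k (E.id k) + 2) k (E.id k) σ.enc
            (fun Q => R.elt _ (E.inputs k τ Q)) fun Q => R.elt _ (z Q)))).symm))
    refine Eq.trans (congrArg avg (funext fun r => ?_)) (avg_comm _)
    refine Eq.trans (congrArg avg (funext fun s => ?_)) (avg_comm _)
    exact avg_comm _
  have h2 : prTrue (E.ideal (adaptiveSim R S π) (derandomized R π).rounds k) =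
      avg fun τ : Tape R (E.id k) (E.coins k) (E.samples k) =>
        avg fun y : R.Carrier (E.id k) => avg fun σ : (adaptiveSim R S π).STape R k (E.id k) =>
          ind (E.verdict k τ.enc
            (idealWorld (adaptiveSim R S π) (π.rounds k (E.id k) + 2) k (E.id k) σ.enc
              (fun Q => R.elt _ (E.inputs k τ Q))
              fun Q => R.elt _ (shares .A (E.inputs k τ .A * E.inputs k τ .B) y Q))).toBool := by
    change prTrue ((unif (Tape R (E.id k) (E.coins k) (E.samples k))).bind fun τ =>
      (pdtShr R (E.id k) _ _).bind fun z =>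
        (unif ((adaptiveSim R S π).STape R k (E.id k))).bind fun σ => PMF.pure _) = _
    rw [prTrue_unif_bind]
    refine congrArg avg (funext fun τ => ?_)
    rw [prTrue_pdtShr_bind .A]
    refine congrArg avg (funext fun y => ?_)
    rw [prTrue_unif_bind]
    simp only [prTrue_pure]
    rfl
  rw [h2]
  simp only [h1, ← avg_add]
  refine congrArg avg (funext fun τ => congrArg avg (funext fun r => congrArg avg
    (funext fun ω => ?_)))
  exact ind_verdict ..

end Probabilities

/-! ### Reductions to the security of the protocol on random inputs -/
section Reductions

open History PolyTime
variable {R : RingFamily} {π : Protocol} {S : SpecialSim}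

theorem Negligible.of_abs_le {f g : ℕ → ℝ} (hf : Negligible f) (h : ∀ k, |g k| ≤ |f k|) :
    Negligible g :=
  Asymptotics.SuperpolynomialDecay.trans_abs_le hf h

theorem Negligible.add {f g : ℕ → ℝ} (hf : Negligible f) (hg : Negligible g) :
    Negligible fun k => f k + g k :=
  Asymptotics.SuperpolynomialDecay.add hf hg

theorem Negligible.abs {f : ℕ → ℝ} (hf : Negligible f) : Negligible fun k => |f k| :=
  hf.of_abs_le fun _ => (abs_abs _).le

theorem Negligible.neg {f : ℕ → ℝ} (hf : Negligible f) : Negligible fun k => -f k :=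
  hf.of_abs_le fun _ => (abs_neg _).le

/-- The profiles in the run whose inputs and tapes form the sample. -/
def earlyProfiles (R : RingFamily) (π : Protocol) (P : Party) (k : ℕ) (id : List Bool) (y : Data) :
    Data :=
  execProfiles R π k id (cons y.fst
    (cons (cons (P.pair y.snd.fst y.snd.snd.fst).fst y.snd.snd.snd.fst)
      (cons (P.pair y.snd.fst y.snd.snd.fst).snd y.snd.snd.snd.snd.fst)))

/-- The profiles when the sample consists of the inputs of the run, the report on the view of `P`
and the output of the other party. -/
def lateProfiles (R : RingFamily) (π : Protocol) (P : Party) (k : ℕ) (id : List Bool) (y : Data) :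
    Data :=
  shareProfiles R P id (P.proj y.fst) (P.proj (cons y.snd.fst y.snd.snd.fst))
    (π.out P k id y.snd.snd.snd.fst.snd)
    (R.query .sub id (P.other.proj y.fst) (P.other.proj (cons y.snd.fst y.snd.snd.fst)))
    y.snd.snd.snd.fst.snd (P.other.proj y.fst) (P.other.proj (cons y.snd.fst y.snd.snd.fst))
    y.snd.snd.snd.snd.fst

theorem polyTime_earlyProfiles (hπ : π.Efficient R) (P : Party) :
    PolyTime R (earlyProfiles R π P) := by
  unfold earlyProfiles
  repeat first
    | exact arg
    | apply (PolyTime.execProfiles hπ).comp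
    | apply PolyTime.pair
    | apply PolyTime.cons
    | apply PolyTime.fst
    | apply PolyTime.snd

theorem polyTime_lateProfiles (hπ : π.Efficient R) (P : Party) :
    PolyTime R (lateProfiles R π P) := by
  unfold lateProfiles shareProfiles profile
  repeat first
    | exact arg
    | exact const _
    | apply (hπ.2.2.2.2.1 _).comp
    | apply PolyTime.pair
    | apply PolyTime.proj
    | apply PolyTime.query
    | apply PolyTime.cons
    | apply PolyTime.fst
    | apply PolyTime.snd

section

variable {E : Environment R} {f prep : ℕ → List Bool → Data → Data} {guard : Data → Data}
  {P : Party} {e : Bool}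

theorem classDistinguisher_prob_pure
    (hf : ∀ k τ, f k (E.id k) (list [E.advice k, Tape.enc τ]) =
      cons (R.elt (E.id k) (E.inputs k τ .A)) (R.elt (E.id k) (E.inputs k τ .B)))
    {k : ℕ} {d : Data} {b : Bool} (hb : (guard d).toBool = b) :
    (classDistinguisher E π.rounds f prep guard P e).prob R k (PMF.pure d) =
      if b = true then classProb E π P e k fun x => prep k (E.id k) (cons x d) else 0 := by
  rw [Distinguisher.prob_pure]
  have h := classDistinguisher_decide (n := π.rounds) (prep := prep) (guard := guard) (P := P)
    (e := e) hf k
  refine (congrArg avg (funext fun τ => congrArg ind (h τ d))).trans ?_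
  rw [hb]
  cases b with
  | true => simp only [Bool.true_and, if_true]; rfl
  | false =>
    refine (avg_const (α := Tape R (E.id k) (E.coins k) (E.samples k)) (ind false)).trans ?_
    simp [ind]

theorem ind_mem (b : Bool) : 0 ≤ ind b ∧ ind b ≤ 1 := by cases b <;> simp [ind]

theorem classProb_mem (k : ℕ) (p : Data → Data) :
    0 ≤ classProb E π P e k p ∧ classProb E π P e k p ≤ 1 := by
  constructor
  · exact (avg_const (α := Tape R (E.id k) (E.coins k) (E.samples k)) 0).symm.le.trans
      (avg_mono fun _ => (ind_mem _).1)
  · exact (avg_mono fun _ => (ind_mem _).2).trans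
      (avg_const (α := Tape R (E.id k) (E.coins k) (E.samples k)) 1).le

theorem classProb_congr {k : ℕ} {p p' : Data → Data}
    (h : ∀ x h', inClass (π.rounds k (E.id k)) P e h' = true → ∀ h, h <:+ h' →
      profileWorld R (π.rounds k (E.id k)) (E.id k) (p x) h =
        profileWorld R (π.rounds k (E.id k)) (E.id k) (p' x) h) :
    classProb E π P e k p = classProb E π P e k p' :=
  congrArg avg (funext fun _ => congrArg ind (E.accepts_congr k _ (h _)))

end

/-- If both parties are corrupt early, the environment sees nothing but a run of `π`, determined by
inputs and tapes that are indistinguishable from uniform ones. -/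
theorem negligible_early {s : Setting} (hπ : π.Efficient R) {E : Environment R}
    (hE : E.Admissible s) {P : Party}
    (h : Indist R s (S.simulatedChoices R P) (uniformChoices R π P)) :
    Negligible fun k => realClass E π P true k - idealClass E π S P true k := by
  obtain ⟨f, hf, hf'⟩ := E.exists_inputs hE
  let D := classDistinguisher E π.rounds f (earlyProfiles R π P) (fun _ => bit true) P true
  refine (h D (classDistinguisher_admissible hE hπ.1 hf' (polyTime_earlyProfiles hπ P)
    (const _))).neg.of_abs_le fun k => le_of_eq (congrArg _ ?_)
  have h1 : D.prob R k (uniformChoices R π P k (E.id k)) = realClass E π P true k := by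
    change D.prob R k ((unif _).bind fun x => (unif _).bind fun ω => PMF.pure _) = _
    simp only [Distinguisher.prob_unif_bind]
    refine congrArg avg (funext fun r => congrArg avg (funext fun ω => ?_))
    rw [classDistinguisher_prob_pure hf (toBool_bit _), if_pos rfl]
    cases P <;> rfl
  have h2 : D.prob R k (S.simulatedChoices R P k (E.id k)) = idealClass E π S P true k := by
    change D.prob R k ((unif (Party → R.Carrier (E.id k))).bind fun x =>
      (pdtShr R (E.id k) (x .A) (x .B)).bind fun z =>
        (unif (S.STape R k (E.id k))).bind fun σ => PMF.pure _) = _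
    rw [Distinguisher.prob_unif_bind]
    refine congrArg avg (funext fun r => ?_)
    rw [Distinguisher.prob_pdtShr_bind (P := P)]
    refine congrArg avg (funext fun y => ?_)
    rw [Distinguisher.prob_unif_bind]
    refine congrArg avg (funext fun σ => ?_)
    rw [classDistinguisher_prob_pure hf (toBool_bit _), if_pos rfl, shares_self]
    rfl
  change _ = -(D.prob R k (S.simulatedChoices R P k (E.id k)) -
    D.prob R k (uniformChoices R π P k (E.id k)))
  rw [h1, h2]; ring

/-- The probability that the special simulator aborts. -/
def abortProb (R : RingFamily) (π : Protocol) (S : SpecialSim) (P : Party) (k : ℕ)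
    (id : List Bool) : ℝ :=
  avg fun r : Party → R.Carrier id => avg fun y : R.Carrier id => avg fun σ : S.STape R k id =>
    ind !(S.report R π P k id (r P) y σ).toBool

theorem staticIdeal_prob (D : Distinguisher) (P : Party) (k : ℕ) (id : List Bool) :
    D.prob R k (staticIdeal R π S P k id) =
      avg fun r : Party → R.Carrier id => avg fun y : R.Carrier id =>
        avg fun σ : S.STape R k id => D.prob R k (PMF.pure (list [R.elt id (r .A), R.elt id (r .B),
          S.report R π P k id (r P) y σ, R.elt id (r .A * r .B - y)])) := by
  change D.prob R k ((unif (Party → R.Carrier id)).bind fun x =>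
    (pdtShr R id (x .A) (x .B)).bind fun z =>
      (unif (S.STape R k id)).bind fun σ => PMF.pure _) = _
  rw [Distinguisher.prob_unif_bind]
  refine congrArg avg (funext fun r => ?_)
  rw [Distinguisher.prob_pdtShr_bind (P := P)]
  refine congrArg avg (funext fun y => ?_)
  rw [Distinguisher.prob_unif_bind]
  simp only [shares_self, shares_other]

theorem staticReal_prob (D : Distinguisher) (P : Party) (k : ℕ) (id : List Bool) :
    D.prob R k (staticReal R π P k id) =
      avg fun r : Party → R.Carrier id => avg fun ω : Party → π.PTape R k id =>
        D.prob R k (PMF.pure (list [R.elt id (r .A), R.elt id (r .B),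
          cons nil (π.view k id (fun Q => R.elt id (r Q)) (fun Q => (ω Q).enc) P),
          π.output k id (fun Q => R.elt id (r Q)) (fun Q => (ω Q).enc) P.other])) := by
  change D.prob R k ((unif _).bind fun x => (unif _).bind fun ω => PMF.pure _) = _
  simp only [Distinguisher.prob_unif_bind]

/-- A run of `π` never aborts, and thus a simulated run rarely does. -/
theorem negligible_abort {s : Setting} {E : Environment R} (hE : E.Admissible s) {P : Party}
    (h : Indist R s (staticReal R π P) (staticIdeal R π S P)) :
    Negligible fun k => abortProb R π S P k (E.id k) := by
  refine (h _ (abortDistinguisher_admissible hE)).neg.of_abs_le fun k => le_of_eq (congrArg _ ?_)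
  have hpure (d : Data) : (abortDistinguisher E.id).prob R k (PMF.pure d) =
      ind !d.snd.snd.fst.toBool := by
    have hb (b : Bool) : (if b = true then Data.nil else bit true).toBool = !b := by
      cases b <;> rfl
    rw [Distinguisher.prob_pure]
    exact (avg_const (α := Tape R (E.id k) 0 0) _).trans (congrArg ind (hb _))
  change _ = -((abortDistinguisher E.id).prob R k (staticReal R π P k (E.id k)) -
    (abortDistinguisher E.id).prob R k (staticIdeal R π S P k (E.id k)))
  rw [staticReal_prob, staticIdeal_prob]
  have h0 : ind (!true) = 0 := by simp [ind]
  simp only [hpure, list, fst_cons, snd_cons, toBool_cons, h0, avg_const, zero_sub, neg_neg]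
  rfl

theorem views_simRun (P : Party) (k : ℕ) (id : List Bool) (r y : R.Carrier id)
    (σ : S.STape R k id) :
    P.proj (π.views k id (simRun S P k id r y σ)) =
      π.view k id (SpecialSim.simInputs P (R.elt id r) (S.choice R P k id r y σ))
        (SpecialSim.simTapes (S.choice R P k id r y σ)) P := by
  have h := Protocol.views_eq (π := π) k id
    (SpecialSim.simInputs P (R.elt id r) (S.choice R P k id r y σ))
    (SpecialSim.simTapes (S.choice R P k id r y σ))
  cases P <;> exact congrArg (Party.proj _) h

theorem proj_cons {id : List Bool} (P : Party) (r : Party → R.Carrier id) :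
    P.proj (cons (R.elt id (r .A)) (R.elt id (r .B))) = R.elt id (r P) := by
  cases P <;> rfl

theorem realProfiles_eq (P : Party) (k : ℕ) (id : List Bool) (r : Party → R.Carrier id)
    (ω : Party → π.PTape R k id) (x : Data) :
    realProfiles R π k id r ω x =
      P.pair
        (profile (P.proj x) (R.elt id (r P))
          (π.output k id (fun Q => R.elt id (r Q)) (fun Q => (ω Q).enc) P)
          (R.query .sub id (P.other.proj x) (R.elt id (r P.other)))
          (π.view k id (fun Q => R.elt id (r Q)) (fun Q => (ω Q).enc) P))
        (profile (P.other.proj x) (R.elt id (r P.other))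
          (π.output k id (fun Q => R.elt id (r Q)) (fun Q => (ω Q).enc) P.other)
          (R.query .sub id (P.proj x) (R.elt id (r P)))
          (π.view k id (fun Q => R.elt id (r Q)) (fun Q => (ω Q).enc) P.other)) := by
  have h := execProfiles_eq (R := R) (π := π) k id (fun Q => Q.proj x) (fun Q => R.elt id (r Q))
    (fun Q => (ω Q).enc)
  cases P <;> exact congrArg₂ Data.cons (h .A) (h .B)

/-- If at most one party is corrupt early, the environment sees nothing of a run of `π` but its
random inputs, one view and one output. -/
theorem negligible_late {s : Setting} (hπ : π.Efficient R) {E : Environment R}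
    (hE : E.Admissible s) {P : Party}
    (h : Indist R s (staticReal R π P) (staticIdeal R π S P)) :
    Negligible fun k => realClass E π P false k - idealClass E π S P false k := by
  obtain ⟨f, hf, hf'⟩ := E.exists_inputs hE
  let D := classDistinguisher E π.rounds f (lateProfiles R π P) (fun d => d.snd.snd.fst) P false
  have hD := h D (classDistinguisher_admissible hE hπ.1 hf' (polyTime_lateProfiles hπ P)
    (fst (snd (snd arg))))
  refine (hD.abs.add (negligible_abort hE h).abs).of_abs_le fun k => ?_
  have h1 : D.prob R k (staticReal R π P k (E.id k)) = realClass E π P false k := by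
    rw [staticReal_prob]
    refine congrArg avg (funext fun r => congrArg avg (funext fun ω => ?_))
    rw [classDistinguisher_prob_pure hf (b := true) rfl, if_pos rfl]
    refine classProb_congr fun x h' hc h hs => ?_
    rw [realProfiles_eq P]
    simp only [lateProfiles, list, fst_cons, snd_cons, proj_cons P r, proj_cons P.other r]
    exact observation_late hc hs _ _ _ _
  have h2 : |D.prob R k (staticIdeal R π S P k (E.id k)) - idealClass E π S P false k| ≤
      abortProb R π S P k (E.id k) := by
    rw [staticIdeal_prob, idealClass, abortProb, ← avg_sub]
    refine (abs_avg_le _).trans (avg_mono fun r => ?_)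
    rw [← avg_sub]
    refine (abs_avg_le _).trans (avg_mono fun y => ?_)
    rw [← avg_sub]
    refine (abs_avg_le _).trans (avg_mono fun σ => ?_)
    rw [classDistinguisher_prob_pure hf (b := (S.report R π P k (E.id k) (r P) y σ).toBool) rfl]
    cases hr : (S.report R π P k (E.id k) (r P) y σ).toBool with
    | true =>
      have hout : (π.out P k (E.id k) (P.proj (π.views k (E.id k) (simRun S P k (E.id k) (r P) y σ))))
          = R.elt (E.id k) y ∧ S.report R π P k (E.id k) (r P) y σ =
            Data.cons Data.nil (P.proj (π.views k (E.id k) (simRun S P k (E.id k) (r P) y σ))) := by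
        rw [views_simRun]
        rw [SpecialSim.report] at hr ⊢
        split_ifs at hr ⊢ with hout
        · exact ⟨hout, rfl⟩
        · cases hr
      have hp : (fun x => lateProfiles R π P k (E.id k) (Data.cons x (list [R.elt (E.id k) (r .A),
          R.elt (E.id k) (r .B), S.report R π P k (E.id k) (r P) y σ,
          R.elt (E.id k) (r .A * r .B - y)]))) = idealProfiles R π S P k (E.id k) r y σ false := by
        funext x
        simp only [lateProfiles, idealProfiles, list, fst_cons, snd_cons, hout, proj_cons P r,
          proj_cons P.other r]
      rw [if_pos rfl, hp]
      simp [ind]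
    | false =>
      rw [if_neg Bool.false_ne_true, zero_sub, abs_neg, abs_of_nonneg (classProb_mem _ _).1]
      exact (classProb_mem _ _).2.trans (by simp [ind])
  change |_| ≤ |(|D.prob R k (staticReal R π P k (E.id k)) -
    D.prob R k (staticIdeal R π S P k (E.id k))|) + _|
  rw [h1]
  have h3 := abs_sub_le (realClass E π P false k) (D.prob R k (staticIdeal R π S P k (E.id k)))
    (idealClass E π S P false k)
  have h4 := le_abs_self (abortProb R π S P k (E.id k))
  exact (h3.trans (add_le_add le_rfl (h2.trans h4))).trans (le_abs_self _)

theorem derandomized_realizesAdaptively {s : Setting} (hπ : RealizesOnRandomInputs R s π) :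
    RealizesAdaptively R s (derandomized R π) := by
  obtain ⟨hπ, S, hS, h⟩ := hπ
  refine ⟨derandomized_efficient hπ, adaptiveSim R S π, adaptiveSim_efficient hπ hS,
    fun E hE => ?_⟩
  have hsum := ((negligible_early hπ hE (h .A).1).add (negligible_late hπ hE (h .A).2)).add
    ((negligible_early hπ hE (h .B).1).add (negligible_late hπ hE (h .B).2))
  refine hsum.of_abs_le fun k => le_of_eq (congrArg _ ?_)
  rw [prTrue_real, prTrue_ideal]
  ring

end Reductions

end ProdShare

end

theorem mainTheorem9 (R : ProdShare.RingFamily) (π : ProdShare.Protocol)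
    (s : ProdShare.Setting) (hπ : ProdShare.RealizesOnRandomInputs R s π) :
    ProdShare.RealizesAdaptively R s (ProdShare.derandomized R π) :=
  ProdShare.derandomized_realizesAdaptively hπ
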